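/- **Setting.** An instance of the delivery problem consists of a connected undirected graph on $n$ nodes with nonnegative real edge lengths, $m$ packages with source and target nodes $s_j,t_j$, and $k>1$ agents with distinct starting nodes $p_1,\dots,p_k$ and reported weights $w'_1,\dots,w'_k\ge 0$. Agents move along edges; each agent carries at most one package at a time and can pick up and drop packages at nodes. A solution $x$ is a schedule after which every package $j$ is at $t_j$. If $d_i(x)$ is the distance travelled by agent $i$, then $\mathrm{cost}(x,w')=\sum_{i=1}^k w'_i\,d_i(x)$. Let $R^\star$ be the set of solutions in which each package is handled by exactly one agent, each package is transported from its source to its target without intermediate dropoffs, and every agent returns to its starting node. For an agent $i$ and a set $M$ of packages, let $G_{i,M}$ be the Stacker-Crane instance with a directed arc $(s_j,t_j)$ for each $j\in M$ and undirected edges $\{t_j,s_{j'}\}$, $\{p_i,s_j\}$, $\{p_i,t_j\}$ for $j,j'\in M$, all weighted by the shortest-path distances of the graph; its tours are the closed walks through $p_i$ that use each arc at least once. **Algorithm $A^k$.** For every assignment of the packages to the agents, that is, for every list $(M_1,\dots,M_k)$ of $k$ pairwise disjoint, possibly empty sets with union $\{1,\dots,m\}$, choose for each agent $i$, independently of the weights,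 an order of $M_i$ such that the round trip from $p_i$ that delivers the packages of $M_i$ one after the other in this order, along shortest paths, has length at most $1.8$ times the weight of every tour of $G_{i,M_i}$. The $k$ round trips together form a solution in $R^\star$; let $R_{A^k}$ be the set of all solutions obtained in this way, one for each assignment. Return a solution $S\in R_{A^k}$, described by the ordered list of packages of each agent, that minimizes $\mathrm{cost}(\cdot,w')$ over $R_{A^k}$. **Theorem.** Algorithm $A^k$ can be implemented, by one program for all instances on a real random access machine with unit costs, to run in time $O(\mathrm{poly}(n,m,k)\cdot k^m)$. The minimum of $\mathrm{cost}(\cdot,w')$ over $R^\star$ exists, and the solution $S\in R^\star$ that $A^k$ finds satisfies $$\mathrm{cost}(S,w')\le 1.8\cdot\min_{x\in R^\star}\mathrm{cost}(x,w').$$ -/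

import Mathlib

/-! ## Instances of the delivery problem -/

namespace Delivery

/-- An instance with `n` nodes, `m` packages and `k > 1` agents: a connected undirected graph with
nonnegative edge lengths, a source and a target for each package, and distinct starting positions
of the agents. The weights of the agents are not part of it. -/
structure Instance (n m k : ℕ) where
  graph : SimpleGraph (Fin n)
  connected : graph.Connected
  len : Sym2 (Fin n) → ℝ
  len_nonneg : ∀ e ∈ graph.edgeSet, 0 ≤ len e
  src : Fin m → Fin n
  tgt : Fin m → Fin n
  start : Fin k → Fin n
  start_injective : Function.Injective start
  one_lt_agents : 1 < k

namespace Instance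

variable {n m k : ℕ} (I : Instance n m k)

/-- Length of a walk in the graph. -/
def walkLen {u v : Fin n} (p : I.graph.Walk u v) : ℝ := (p.edges.map I.len).sum

/-- Length of a shortest path (the graph is connected and lengths are nonnegative, so that this
infimum is over a nonempty set that is bounded below). -/
noncomputable def dist (u v : Fin n) : ℝ := ⨅ p : I.graph.Walk u v, I.walkLen p

theorem dist_comm (u v : Fin n) : I.dist u v = I.dist v u := by
  unfold dist
  refine Equiv.iInf_congr ⟨fun p => p.reverse, fun p => p.reverse, ?_, ?_⟩ ?_
  · intro p; simp
  · intro p; simp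
  · intro p; simp [walkLen, List.sum_reverse]

end Instance

/-! ## Solutions as schedules -/

/-- Elementary actions of the agents. -/
inductive Event (n m k : ℕ) where
  /-- agent `i` moves along an edge to the node `v` -/
  | move (i : Fin k) (v : Fin n)
  /-- agent `i` picks up package `j` at its current node -/
  | pickup (i : Fin k) (j : Fin m)
  /-- agent `i` drops package `j` at its current node -/
  | drop (i : Fin k) (j : Fin m)

/-- Positions of the agents, the package carried by each agent (at most one), and the node at which
each package lies (`none` while it is carried). -/
structure State (n m k : ℕ) where
  pos : Fin k → Fin n
  load : Fin k → Option (Fin m)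
  loc : Fin m → Option (Fin n)

/-- A schedule: the actions of all agents, in chronological order. -/
abbrev Schedule (n m k : ℕ) := List (Event n m k)

/-- The packages picked up by agent `i`, in chronological order. -/
def Schedule.order {n m k : ℕ} (x : Schedule n m k) (i : Fin k) : List (Fin m) :=
  x.filterMap fun e =>
    match e with
    | .pickup a j => if a = i then some j else none
    | _ => none

/-- The number of times package `j` is dropped. -/
def Schedule.dropCount {n m k : ℕ} (x : Schedule n m k) (j : Fin m) : ℕ :=
  x.countP fun e =>
    match e with
    | .drop _ j' => decide (j' = j)
    | _ => false

namespace Instance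

variable {n m k : ℕ} (I : Instance n m k)

/-- The initial state. -/
def init : State n m k where
  pos := I.start
  load := fun _ => none
  loc := fun j => some (I.src j)

/-- Effect and admissibility of a single action. -/
inductive Step : State n m k → Event n m k → State n m k → Prop
  | move (s : State n m k) (i : Fin k) (v : Fin n) (h : I.graph.Adj (s.pos i) v) :
      Step s (.move i v) { s with pos := Function.update s.pos i v }
  | pickup (s : State n m k) (i : Fin k) (j : Fin m)
      (hfree : s.load i = none) (hloc : s.loc j = some (s.pos i)) :
      Step s (.pickup i j)
        { s with load := Function.update s.load i (some j), loc := Function.update s.loc j none }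
  | drop (s : State n m k) (i : Fin k) (j : Fin m) (hload : s.load i = some j) :
      Step s (.drop i j)
        { s with load := Function.update s.load i none,
                 loc := Function.update s.loc j (some (s.pos i)) }

/-- Execution of a schedule. -/
inductive Run : State n m k → Schedule n m k → State n m k → Prop
  | nil (s : State n m k) : Run s [] s
  | cons {s s₁ s₂ : State n m k} {e : Event n m k} {x : Schedule n m k}
      (h : I.Step s e s₁) (hx : Run s₁ x s₂) : Run s (e :: x) s₂

/-- Distance travelled by agent `i` from given positions of the agents. -/
def travelFrom (i : Fin k) : (Fin k → Fin n) → Schedule n m k → ℝ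
  | _, [] => 0
  | pos, .move a v :: x =>
      (if a = i then I.len s(pos a, v) else 0) + travelFrom i (Function.update pos a v) x
  | pos, .pickup _ _ :: x => travelFrom i pos x
  | pos, .drop _ _ :: x => travelFrom i pos x

/-- The travel distance `d_i(x)`. -/
def travel (x : Schedule n m k) (i : Fin k) : ℝ := I.travelFrom i I.start x

/-- The total energy `∑ i, w_i * d_i(x)`. -/
def cost (w : Fin k → ℝ) (x : Schedule n m k) : ℝ := ∑ i, w i * I.travel x i

/-- Feasible solutions: the schedule can be executed and delivers every package. -/
def IsFeasible (x : Schedule n m k) : Prop :=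
  ∃ s, I.Run I.init x s ∧ ∀ j, s.loc j = some (I.tgt j)

/-- Non-collaborative solutions: each package is handled by exactly one agent. -/
def IsNonCollaborative (x : Schedule n m k) : Prop :=
  I.IsFeasible x ∧ ∀ j, ∃! i, Event.pickup i j ∈ x

/-- Non-collaborative solutions with direct delivery (each package is dropped only once, hence
without intermediate dropoffs) in which every agent returns to its starting position. -/
def directReturn : Set (Schedule n m k) :=
  {x | I.IsNonCollaborative x ∧ (∀ j, x.dropCount j = 1) ∧
    ∃ s, I.Run I.init x s ∧ ∀ i, s.pos i = I.start i}

end Instance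

/-! ## Stacker-Crane instances -/

/-- A weighted mixed graph on `V` with directed arcs indexed by `ι` and undirected edges. -/
structure StackerCrane (V ι : Type) where
  tail : ι → V
  head : ι → V
  arcWeight : ι → ℝ
  edges : Set (Sym2 V)
  edgeWeight : Sym2 V → ℝ

/-- `S.Walk u v l c`: there is a walk from `u` to `v` of weight `c` that traverses the arcs in `l`,
in this order; arcs are traversed forwards only, edges in both directions. -/
inductive StackerCrane.Walk {V ι : Type} (S : StackerCrane V ι) :
    V → V → List ι → ℝ → Prop
  | nil (u : V) : S.Walk u u [] 0
  | arc (a : ι) {v : V} {l : List ι} {c : ℝ} (h : S.Walk (S.head a) v l c) :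
      S.Walk (S.tail a) v (a :: l) (S.arcWeight a + c)
  | edge {u v z : V} {l : List ι} {c : ℝ} (he : s(u, v) ∈ S.edges) (h : S.Walk v z l c) :
      S.Walk u z l (S.edgeWeight s(u, v) + c)

/-- `S.IsTour p c`: there is a closed walk through `p` of weight `c` that uses every arc at least
once. -/
def StackerCrane.IsTour {V ι : Type} (S : StackerCrane V ι) (p : V) (c : ℝ) : Prop :=
  ∃ l : List ι, S.Walk p p l c ∧ ∀ a, a ∈ l

namespace Instance

variable {n m k : ℕ} (I : Instance n m k)

/-- The Stacker-Crane instance of agent `i` and a set `M` of packages: an arc from source to target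
for each package of `M`, and edges target-source, start-source and start-target, all weighted by
distance (nodes other than the start, the sources and the targets are isolated). -/
noncomputable def stackerCrane (i : Fin k) (M : Finset (Fin m)) :
    StackerCrane (Fin n) {j : Fin m // j ∈ M} where
  tail j := I.src j
  head j := I.tgt j
  arcWeight j := I.dist (I.src j) (I.tgt j)
  edges := {e | (∃ j₁ ∈ M, ∃ j₂ ∈ M, e = s(I.tgt j₁, I.src j₂)) ∨
    (∃ j ∈ M, e = s(I.start i, I.src j)) ∨ (∃ j ∈ M, e = s(I.start i, I.tgt j))}
  edgeWeight := Sym2.lift ⟨I.dist, I.dist_comm⟩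

/-- Length of the route that starts at `u`, delivers the listed packages one by one along shortest
paths, and ends at `p`. -/
noncomputable def routeLen (p : Fin n) : Fin n → List (Fin m) → ℝ
  | u, [] => I.dist u p
  | u, j :: l => I.dist u (I.src j) + I.dist (I.src j) (I.tgt j) + routeLen p (I.tgt j) l

/-- Length of the round trip of agent `i` that delivers the listed packages in this order. -/
noncomputable def tourLen (i : Fin k) (l : List (Fin m)) : ℝ :=
  I.routeLen (I.start i) (I.start i) l

/-- The list `l` is an order of the packages in `M` whose round trip is an `r`-approximation for
the Stacker-Crane instance of agent `i` and `M`. -/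
def IsTourApprox (r : ℝ) (i : Fin k) (M : Finset (Fin m)) (l : List (Fin m)) : Prop :=
  l.Nodup ∧ l.toFinset = M ∧ ∀ c, (I.stackerCrane i M).IsTour (I.start i) c → I.tourLen i l ≤ r * c

/-- A plan: the list of packages that each agent delivers, in this order. -/
abbrev Plan (_ : Instance n m k) := Fin k → List (Fin m)

/-- Cost of a plan. -/
noncomputable def planCost (w : Fin k → ℝ) (L : I.Plan) : ℝ := ∑ i, w i * I.tourLen i (L i)

/-- A schedule executes a plan if every agent delivers its packages in the given order, with travel
distance equal to the length of its shortest round trip for this order. -/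
def Executes (x : Schedule n m k) (L : I.Plan) : Prop :=
  x ∈ I.directReturn ∧ ∀ i, x.order i = L i ∧ I.travel x i = I.tourLen i (L i)

end Instance

/-- A rule that chooses an order for every agent and every set of packages, from the instance
without the weights. -/
abbrev TourRule := ∀ {n m k : ℕ}, Instance n m k → Fin k → Finset (Fin m) → List (Fin m)

/-- The plan combined from the tours of the agents, for the assignment `f` of packages to agents
(that is, for the list of `k` possibly empty sets `{j | f j = i}`). -/
def TourRule.plan (T : TourRule) {n m k : ℕ} (I : Instance n m k) (f : Fin m → Fin k) : I.Plan :=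
  fun i => T I i (Finset.univ.filter fun j => f j = i)

/-- The set of plans, one for each assignment, among which the algorithm chooses. -/
def TourRule.plans (T : TourRule) {n m k : ℕ} (I : Instance n m k) : Set I.Plan :=
  Set.range (T.plan I)

/-! ## Programs for a real random access machine with unit costs

Memory cells hold natural numbers or real numbers and are organised in two-dimensional arrays, which
can be addressed indirectly. Natural numbers can be added, subtracted (truncated) and compared;
real numbers can be added, subtracted, multiplied and compared. Each operation costs one unit. -/

/-- Memory contents: `nat a i j` and `real a i j` are the cells `(i, j)` of the `a`-th arrays. -/
structure Store where
  nat : ℕ → ℕ → ℕ → ℕ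
  real : ℕ → ℕ → ℕ → ℝ

/-- Expressions with natural values. -/
inductive NExp where
  | const (c : ℕ)
  | get (a : ℕ) (i j : NExp)
  | add (e₁ e₂ : NExp)
  | sub (e₁ e₂ : NExp)

def NExp.eval (s : Store) : NExp → ℕ
  | const c => c
  | get a i j => s.nat a (i.eval s) (j.eval s)
  | add e₁ e₂ => e₁.eval s + e₂.eval s
  | sub e₁ e₂ => e₁.eval s - e₂.eval s

/-- Number of operations in an expression. -/
def NExp.size : NExp → ℕ
  | const _ => 1
  | get _ i j => 1 + i.size + j.size
  | add e₁ e₂ => 1 + e₁.size + e₂.size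
  | sub e₁ e₂ => 1 + e₁.size + e₂.size

/-- Expressions with real values. -/
inductive RExp where
  | zero
  | one
  | get (a : ℕ) (i j : NExp)
  | add (e₁ e₂ : RExp)
  | sub (e₁ e₂ : RExp)
  | mul (e₁ e₂ : RExp)

def RExp.eval (s : Store) : RExp → ℝ
  | zero => 0
  | one => 1
  | get a i j => s.real a (i.eval s) (j.eval s)
  | add e₁ e₂ => e₁.eval s + e₂.eval s
  | sub e₁ e₂ => e₁.eval s - e₂.eval s
  | mul e₁ e₂ => e₁.eval s * e₂.eval s

/-- Number of operations in an expression. -/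
def RExp.size : RExp → ℕ
  | zero => 1
  | one => 1
  | get _ i j => 1 + i.size + j.size
  | add e₁ e₂ => 1 + e₁.size + e₂.size
  | sub e₁ e₂ => 1 + e₁.size + e₂.size
  | mul e₁ e₂ => 1 + e₁.size + e₂.size

/-- Tests. -/
inductive BExp where
  | natLe (e₁ e₂ : NExp)
  | realLe (e₁ e₂ : RExp)
  | not (b : BExp)
  | and (b₁ b₂ : BExp)

def BExp.holds (s : Store) : BExp → Prop
  | natLe e₁ e₂ => e₁.eval s ≤ e₂.eval s
  | realLe e₁ e₂ => e₁.eval s ≤ e₂.eval s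
  | not b => ¬ b.holds s
  | and b₁ b₂ => b₁.holds s ∧ b₂.holds s

/-- Number of operations in a test. -/
def BExp.size : BExp → ℕ
  | natLe e₁ e₂ => 1 + e₁.size + e₂.size
  | realLe e₁ e₂ => 1 + e₁.size + e₂.size
  | not b => 1 + b.size
  | and b₁ b₂ => 1 + b₁.size + b₂.size

/-- Programs. -/
inductive Program where
  | skip
  /-- store the value of `e` in cell `(i, j)` of the `a`-th array of natural numbers -/
  | setNat (a : ℕ) (i j e : NExp)
  /-- store the value of `e` in cell `(i, j)` of the `a`-th array of real numbers -/
  | setReal (a : ℕ) (i j : NExp) (e : RExp)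
  | seq (P Q : Program)
  | ite (b : BExp) (P Q : Program)
  | loop (b : BExp) (P : Program)

def Store.setNat (s : Store) (a i j x : ℕ) : Store :=
  { s with nat := fun a' i' j' => if a' = a ∧ i' = i ∧ j' = j then x else s.nat a' i' j' }

noncomputable def Store.setReal (s : Store) (a i j : ℕ) (x : ℝ) : Store :=
  { s with real := fun a' i' j' => if a' = a ∧ i' = i ∧ j' = j then x else s.real a' i' j' }

/-- `P.Exec s s' t`: started in memory `s`, the program `P` halts in memory `s'` after `t` steps. -/
inductive Program.Exec : Program → Store → Store → ℕ → Prop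
  | skip (s : Store) : Exec .skip s s 1
  | setNat (s : Store) (a : ℕ) (i j e : NExp) :
      Exec (.setNat a i j e) s (s.setNat a (i.eval s) (j.eval s) (e.eval s))
        (1 + i.size + j.size + e.size)
  | setReal (s : Store) (a : ℕ) (i j : NExp) (e : RExp) :
      Exec (.setReal a i j e) s (s.setReal a (i.eval s) (j.eval s) (e.eval s))
        (1 + i.size + j.size + e.size)
  | seq {P Q : Program} {s s₁ s₂ : Store} {t₁ t₂ : ℕ}
      (hP : Exec P s s₁ t₁) (hQ : Exec Q s₁ s₂ t₂) : Exec (.seq P Q) s s₂ (t₁ + t₂)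
  | iteTrue {b : BExp} {P Q : Program} {s s₁ : Store} {t : ℕ}
      (hb : b.holds s) (hP : Exec P s s₁ t) : Exec (.ite b P Q) s s₁ (1 + b.size + t)
  | iteFalse {b : BExp} {P Q : Program} {s s₁ : Store} {t : ℕ}
      (hb : ¬ b.holds s) (hQ : Exec Q s s₁ t) : Exec (.ite b P Q) s s₁ (1 + b.size + t)
  | loopTrue {b : BExp} {P : Program} {s s₁ s₂ : Store} {t₁ t₂ : ℕ}
      (hb : b.holds s) (hP : Exec P s s₁ t₁) (hL : Exec (.loop b P) s₁ s₂ t₂) :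
      Exec (.loop b P) s s₂ (1 + b.size + t₁ + t₂)
  | loopFalse {b : BExp} {P : Program} {s : Store} (hb : ¬ b.holds s) :
      Exec (.loop b P) s s (1 + b.size)

/-- An array given by a function on `Fin N`, filled up with zeros. -/
def pad {N : ℕ} {α : Type} [Zero α] (f : Fin N → α) (i : ℕ) : α :=
  if h : i < N then f ⟨i, h⟩ else 0

open Classical in
/-- The input: the numbers `n`, `m`, `k`, the adjacency matrix, the starting positions, sources and
targets, and the lengths of the edges and the weights of the agents; all other cells are zero. -/
noncomputable def Instance.input {n m k : ℕ} (I : Instance n m k) (w : Fin k → ℝ) : Store where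
  nat a i j :=
    match a, i, j with
    | 0, 0, 0 => n
    | 0, 0, 1 => m
    | 0, 0, 2 => k
    | 1, u, v => pad (fun u => pad (fun v => if I.graph.Adj u v then 1 else 0) v) u
    | 2, i, 0 => pad (fun i => (I.start i : ℕ)) i
    | 3, j, 0 => pad (fun j => (I.src j : ℕ)) j
    | 4, j, 0 => pad (fun j => (I.tgt j : ℕ)) j
    | _, _, _ => 0
  real a i j :=
    match a, i, j with
    | 0, u, v => pad (fun u => pad (fun v => if I.graph.Adj u v then I.len s(u, v) else 0) v) u
    | 1, i, 0 => pad w i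
    | _, _, _ => 0

/-- The memory contains the plan `L` as output: the lengths of the lists in the array 5, the lists
in the rows of the array 6. -/
def Store.Outputs (s : Store) {n m k : ℕ} {I : Instance n m k} (L : I.Plan) : Prop :=
  ∀ i : Fin k, s.nat 5 i 0 = (L i).length ∧
    ∀ (r : ℕ) (hr : r < (L i).length), s.nat 6 i r = ((L i)[r] : ℕ)

end Delivery

namespace Delivery

namespace Instance

variable {n m k : ℕ} (I : Instance n m k)

/-! ## Shortest-path distances -/

/-! The running time $k^m$ with $k>1$ leaves room for exact tours. Since $2^m\le k^m$, a dynamic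
program over the sets of packages, in the manner of Held and Karp, can find a shortest round trip
for every agent and every set. `optTourRule` chooses these round trips; the factor 9/5 is then pure
slack, for the single tours as well as for the final solution.

Optimality rests on two shortcut arguments and one construction. A tour of a Stacker-Crane instance
traverses every arc, and by the triangle inequality it is no shorter than the round trip along one
occurrence of each arc (`routeLen_le_of_walk`). In a solution of `directReturn` every package is
dropped once, hence picked up once, and is carried from its source to its target by one agent; so
each agent travels at least the round trip in its order of pickups (`Run.routeLen_le_travelFrom`).
Conversely, a plan becomes a schedule when the agents work one after the other (`exists_executes`).
With nonnegative weights, the cheapest plan therefore attains the minimum over `directReturn`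
(`isLeast_planCost`).

The running time is read off the syntax of the program. Loops bounded by a size in the input run at
most $q=n+m+k$ times, all others at most $R=k^m$ times. By `exists_time_le` the time is at most
$Cq^DR^d$, where $d$ is the nesting depth of loops of the second kind and $C$, $D$ depend on the
program only. In `cheapestPlan` this depth is one.

The program is verified by loop invariants (`Ends.forLoop`), while `Exec.frame` takes care of all
arrays that a piece of code does not write. Its ingredients are the algorithm of Floyd and Warshall,
a membership table for binary codes of sets, the Bellman recursion in increasing order of codes, and
a list of all assignments grown by one package at a time. Ties are broken by the smallest index, so
that the tours in memory are the ones that the rule fixes. -/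

theorem len_nonneg_of_adj {u v : Fin n} (h : I.graph.Adj u v) : 0 ≤ I.len s(u, v) :=
  I.len_nonneg _ h

theorem walkLen_nonneg {u v : Fin n} (p : I.graph.Walk u v) : 0 ≤ I.walkLen p := by
  refine List.sum_nonneg fun x hx => ?_
  obtain ⟨e, he, rfl⟩ := List.mem_map.1 hx
  exact I.len_nonneg e (p.edges_subset_edgeSet he)

@[simp] theorem walkLen_nil (u : Fin n) : I.walkLen (.nil : I.graph.Walk u u) = 0 := by
  simp [walkLen]

@[simp] theorem walkLen_cons {u v z : Fin n} (h : I.graph.Adj u v) (p : I.graph.Walk v z) :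
    I.walkLen (.cons h p) = I.len s(u, v) + I.walkLen p := by
  simp [walkLen]

theorem walkLen_append {u v z : Fin n} (p : I.graph.Walk u v) (q : I.graph.Walk v z) :
    I.walkLen (p.append q) = I.walkLen p + I.walkLen q := by
  simp [walkLen]

theorem dist_le_walkLen {u v : Fin n} (p : I.graph.Walk u v) : I.dist u v ≤ I.walkLen p :=
  ciInf_le ⟨0, by rintro _ ⟨q, rfl⟩; exact I.walkLen_nonneg q⟩ p

theorem le_dist {u v : Fin n} {c : ℝ} (h : ∀ p : I.graph.Walk u v, c ≤ I.walkLen p) :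
    c ≤ I.dist u v :=
  have : Nonempty (I.graph.Walk u v) := I.connected.preconnected u v
  le_ciInf h

theorem dist_nonneg (u v : Fin n) : 0 ≤ I.dist u v := I.le_dist I.walkLen_nonneg

@[simp] theorem dist_self (u : Fin n) : I.dist u u = 0 :=
  le_antisymm (by simpa using I.dist_le_walkLen (.nil : I.graph.Walk u u)) (I.dist_nonneg u u)

/-- Cutting out detours removes edges of nonnegative length only. This reduces the infimum over all
walks to a minimum over the finitely many paths. -/
theorem walkLen_bypass_le {u v : Fin n} (p : I.graph.Walk u v) :
    I.walkLen p.bypass ≤ I.walkLen p := by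
  refine List.Sublist.sum_le_sum (p.edges_bypass_sublist_edges.map I.len) fun x hx => ?_
  obtain ⟨e, he, rfl⟩ := List.mem_map.1 hx
  exact I.len_nonneg e (p.edges_subset_edgeSet he)

/-- Shortest paths exist. -/
theorem exists_isPath_walkLen_eq_dist (u v : Fin n) :
    ∃ p : I.graph.Walk u v, p.IsPath ∧ I.walkLen p = I.dist u v := by
  classical
  obtain ⟨q⟩ := I.connected.preconnected u v
  have : Nonempty (I.graph.Path u v) := ⟨q.toPath⟩
  obtain ⟨p, hp⟩ := Finite.exists_min fun p : I.graph.Path u v => I.walkLen p.1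
  refine ⟨p.1, p.2, le_antisymm (I.le_dist fun r => ?_) (I.dist_le_walkLen _)⟩
  exact (hp r.toPath).trans (I.walkLen_bypass_le r)

theorem dist_triangle (u v z : Fin n) : I.dist u z ≤ I.dist u v + I.dist v z := by
  obtain ⟨p, -, hp⟩ := I.exists_isPath_walkLen_eq_dist u v
  obtain ⟨q, -, hq⟩ := I.exists_isPath_walkLen_eq_dist v z
  rw [← hp, ← hq, ← walkLen_append]
  exact I.dist_le_walkLen _

theorem dist_le_len {u v : Fin n} (h : I.graph.Adj u v) : I.dist u v ≤ I.len s(u, v) := by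
  simpa using I.dist_le_walkLen (.cons h .nil)

open Classical in
/-- Length of the edge between two nodes, zero if there is none. -/
noncomputable def edgeLen (u v : Fin n) : ℝ := if I.graph.Adj u v then I.len s(u, v) else 0

theorem edgeLen_nonneg (u v : Fin n) : 0 ≤ I.edgeLen u v := by
  unfold edgeLen
  split_ifs with h
  exacts [I.len_nonneg_of_adj h, le_rfl]

/-- The distances are bounded by the sum of all edge lengths. -/
theorem dist_le_sum (u v : Fin n) : I.dist u v ≤ ∑ x, ∑ y, I.edgeLen x y := by
  classical
  -- A shortest path uses no dart twice, so its length is a partial sum of the sum over all ordered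
  -- pairs.
  obtain ⟨p, hp, hd⟩ := I.exists_isPath_walkLen_eq_dist u v
  have hnd : (p.darts.map fun d => (d.fst, d.snd)).Nodup := by
    refine (List.nodup_map_iff fun a b hab => ?_).2
      (SimpleGraph.Walk.darts_nodup_of_support_nodup hp.support_nodup)
    exact SimpleGraph.Dart.ext _ _ hab
  have hlen : I.walkLen p = ((p.darts.map fun d => (d.fst, d.snd)).map
      fun a => I.edgeLen a.1 a.2).sum := by
    simp only [walkLen, SimpleGraph.Walk.edges, List.map_map]
    congr 1
    refine List.map_congr_left fun d _ => ?_
    simp [edgeLen, d.adj, SimpleGraph.Dart.edge]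
  rw [← hd, hlen, ← List.sum_toFinset _ hnd, ← Fintype.sum_prod_type']
  exact Finset.sum_le_sum_of_subset_of_nonneg (Finset.subset_univ _)
    fun a _ _ => I.edgeLen_nonneg _ _

/-- A function that vanishes on the diagonal, is bounded by the edge lengths and satisfies the
triangle inequality is bounded by the distance. -/
theorem le_dist_of_triangle (D : Fin n → Fin n → ℝ) (h0 : ∀ u, D u u = 0)
    (hlen : ∀ u v, I.graph.Adj u v → D u v ≤ I.len s(u, v))
    (htri : ∀ u v z, D u z ≤ D u v + D v z) (u v : Fin n) : D u v ≤ I.dist u v := by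
  refine I.le_dist fun p => ?_
  induction p with
  | nil => simp [h0]
  | @cons u v z h p ih => rw [walkLen_cons]; linarith [htri u v z, hlen _ _ h]

/-! ## Round trips -/

/-- Shortcut principle behind both lower bounds: a detour through `v` before the route never helps.
-/
theorem routeLen_triangle (p u v : Fin n) (l : List (Fin m)) :
    I.routeLen p u l ≤ I.dist u v + I.routeLen p v l := by
  cases l with
  | nil => exact I.dist_triangle u v p
  | cons j l => simp only [routeLen]; linarith [I.dist_triangle u v (I.src j)]

theorem routeLen_nonneg (p u : Fin n) (l : List (Fin m)) : 0 ≤ I.routeLen p u l := by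
  induction l generalizing u with
  | nil => exact I.dist_nonneg u p
  | cons j l ih =>
    simp only [routeLen]
    linarith [I.dist_nonneg u (I.src j), I.dist_nonneg (I.src j) (I.tgt j), ih (I.tgt j)]

/-- Length of the trip from `u` to the source of package `j` and on to its target. -/
noncomputable def legLen (u : Fin n) (j : Fin m) : ℝ := I.dist u (I.src j) + I.dist (I.src j) (I.tgt j)

/-- Length of a shortest route from `u` that delivers `r` packages of `M` and ends at `p`. -/
noncomputable def optLenAux (p : Fin n) : ℕ → Finset (Fin m) → Fin n → ℝ
  | 0, _, u => I.dist u p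
  | r + 1, M, u =>
    if h : M.Nonempty then M.inf' h fun j => I.legLen u j + optLenAux p r (M.erase j) (I.tgt j)
    else I.dist u p

/-- Length of a shortest route from `u` that delivers the packages of `M` and ends at `p`. -/
noncomputable def optLen (p : Fin n) (M : Finset (Fin m)) (u : Fin n) : ℝ :=
  I.optLenAux p M.card M u

/-- Length of a shortest such route that delivers package `j` first. -/
noncomputable def optVia (p : Fin n) (M : Finset (Fin m)) (u : Fin n) (j : Fin m) : ℝ :=
  I.legLen u j + I.optLen p (M.erase j) (I.tgt j)

@[simp] theorem optLen_empty (p u : Fin n) : I.optLen p ∅ u = I.dist u p := by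
  simp [optLen, optLenAux]

/-- Bellman equation. The counter in `optLenAux` only makes the recursion structural; it stays equal
to the cardinality, since both drop by one when a package is erased. -/
theorem optLen_eq_inf' (p u : Fin n) {M : Finset (Fin m)} (h : M.Nonempty) :
    I.optLen p M u = M.inf' h (I.optVia p M u) := by
  obtain ⟨r, hr⟩ : ∃ r, M.card = r + 1 := ⟨M.card - 1, by have := h.card_pos; omega⟩
  rw [optLen, hr, optLenAux, dif_pos h]
  refine Finset.inf'_congr h rfl fun j hj => ?_
  rw [optVia, optLen, Finset.card_erase_of_mem hj, hr, Nat.add_sub_cancel]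

/-- Package `b` is the first one among those packages of `M` that minimize `g`. -/
def IsFirstArgmin (M : Finset (Fin m)) (g : Fin m → ℝ) (b : Fin m) : Prop :=
  b ∈ M ∧ ∀ j ∈ M, g b ≤ g j ∧ (j < b → g b < g j)

/-- Breaking ties by index determines the next package, so an entry of the computed table can be
identified with the choice in `optTourRule`. -/
theorem IsFirstArgmin.unique {M : Finset (Fin m)} {g : Fin m → ℝ} {a b : Fin m}
    (ha : IsFirstArgmin M g a) (hb : IsFirstArgmin M g b) : a = b := by
  rcases lt_trichotomy a b with h | h | h
  · exact absurd ((hb.2 a ha.1).2 h) (not_lt.2 (ha.2 b hb.1).1)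
  · exact h
  · exact absurd ((ha.2 b hb.1).2 h) (not_lt.2 (hb.2 a ha.1).1)

theorem exists_isFirstArgmin {M : Finset (Fin m)} (hM : M.Nonempty) (g : Fin m → ℝ) :
    ∃ b, IsFirstArgmin M g b := by
  classical
  obtain ⟨a, haM, ha⟩ := M.exists_min_image g hM
  let A := M.filter fun j => g j = g a
  have hA : A.Nonempty := ⟨a, by simp [A, haM]⟩
  have hmin := Finset.mem_filter.1 (A.min'_mem hA)
  refine ⟨A.min' hA, hmin.1, fun j hj => ⟨hmin.2 ▸ ha j hj, fun hlt => ?_⟩⟩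
  refine lt_of_le_of_ne (hmin.2 ▸ ha j hj) fun he => ?_
  exact absurd (A.min'_le j (Finset.mem_filter.2 ⟨hj, by rw [← he, hmin.2]⟩)) (not_le.2 hlt)

theorem IsFirstArgmin.optLen_eq {p u : Fin n} {M : Finset (Fin m)} {b : Fin m}
    (h : IsFirstArgmin M (I.optVia p M u) b) : I.optLen p M u = I.optVia p M u b := by
  rw [I.optLen_eq_inf' p u ⟨b, h.1⟩]
  exact le_antisymm (Finset.inf'_le _ h.1) (Finset.le_inf' _ _ fun j hj => (h.2 j hj).1)

/-- The order in which a shortest route from `u` to `p` delivers the packages of `M`, if the first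
optimal package is chosen each time. -/
inductive IsGreedy (p : Fin n) : Fin n → Finset (Fin m) → List (Fin m) → Prop
  | nil (u : Fin n) : IsGreedy p u ∅ []
  | cons {u : Fin n} {M : Finset (Fin m)} {j : Fin m} {l : List (Fin m)}
      (hj : IsFirstArgmin M (I.optVia p M u) j) (hl : IsGreedy p (I.tgt j) (M.erase j) l) :
      IsGreedy p u M (j :: l)

variable {I}

theorem IsGreedy.unique {p u : Fin n} {M : Finset (Fin m)} {l l' : List (Fin m)}
    (h : I.IsGreedy p u M l) (h' : I.IsGreedy p u M l') : l = l' := by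
  induction h generalizing l' with
  | nil u =>
    cases h' with
    | nil => rfl
    | cons hj _ => simpa using hj.1
  | cons hj _ ih =>
    cases h' with
    | nil => simpa using hj.1
    | cons hj' hl' =>
      obtain rfl := hj.unique hj'
      rw [ih hl']

theorem IsGreedy.nodup_toFinset {p u : Fin n} {M : Finset (Fin m)} {l : List (Fin m)}
    (h : I.IsGreedy p u M l) : l.Nodup ∧ l.toFinset = M := by
  induction h with
  | nil u => simp
  | @cons u M j l hj _ ih =>
    refine ⟨List.nodup_cons.2 ⟨fun hm => ?_, ih.1⟩, ?_⟩
    · have := List.mem_toFinset.2 hm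
      rw [ih.2] at this
      simp at this
    · rw [List.toFinset_cons, ih.2, Finset.insert_erase hj.1]

theorem IsGreedy.length_eq {p u : Fin n} {M : Finset (Fin m)} {l : List (Fin m)}
    (h : I.IsGreedy p u M l) : l.length = M.card := by
  rw [← h.nodup_toFinset.2, List.toFinset_card_of_nodup h.nodup_toFinset.1]

theorem IsGreedy.routeLen_eq {p u : Fin n} {M : Finset (Fin m)} {l : List (Fin m)}
    (h : I.IsGreedy p u M l) : I.routeLen p u l = I.optLen p M u := by
  induction h with
  | nil u => simp [routeLen]
  | cons hj _ ih => rw [routeLen, ih, hj.optLen_eq, optVia, legLen]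

variable (I)

theorem exists_isGreedy (p u : Fin n) (M : Finset (Fin m)) : ∃ l, I.IsGreedy p u M l := by
  induction M using Finset.strongInduction generalizing u with
  | H M ih =>
    rcases M.eq_empty_or_nonempty with rfl | hM
    · exact ⟨[], .nil u⟩
    · obtain ⟨j, hj⟩ := exists_isFirstArgmin hM (I.optVia p M u)
      obtain ⟨l, hl⟩ := ih _ (Finset.erase_ssubset hj.1) (I.tgt j)
      exact ⟨j :: l, .cons hj hl⟩

/-- Each package of a given route is one of the candidates in the Bellman minimum at that point. -/
theorem optLen_le_routeLen (p u : Fin n) (l : List (Fin m)) (hl : l.Nodup) :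
    I.optLen p l.toFinset u ≤ I.routeLen p u l := by
  induction l generalizing u with
  | nil => simp [routeLen]
  | cons j l ih =>
    rw [List.nodup_cons] at hl
    have hj : j ∈ (j :: l).toFinset := by simp
    have he : (j :: l).toFinset.erase j = l.toFinset := by
      rw [List.toFinset_cons, Finset.erase_insert (by simpa using hl.1)]
    rw [I.optLen_eq_inf' p u ⟨j, hj⟩]
    refine (Finset.inf'_le _ hj).trans ?_
    rw [optVia, he, legLen, routeLen]
    linarith [ih (I.tgt j) hl.2]

/-! ## Tours of the Stacker-Crane instances -/

/-- Quantifying over all sublists of the traversed arcs lets the induction skip an arc: a skipped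
arc is a detour, absorbed by the triangle inequality just like an edge. -/
theorem routeLen_le_of_walk {i : Fin k} {M : Finset (Fin m)} {u v : Fin n}
    {a : List {j : Fin m // j ∈ M}} {c : ℝ} (h : (I.stackerCrane i M).Walk u v a c) :
    ∀ l : List (Fin m), List.Sublist l (a.map Subtype.val) → I.routeLen v u l ≤ c := by
  induction h with
  | nil u => intro l hl; simp at hl; simp [hl, routeLen]
  | @arc b v a c h ih =>
    intro l hl
    simp only [stackerCrane] at ih ⊢
    rw [List.map_cons, List.sublist_cons_iff] at hl
    rcases hl with hl | ⟨r, rfl, hr⟩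
    · linarith [I.routeLen_triangle v (I.src b) (I.tgt b) l, ih l hl]
    · simp only [routeLen, dist_self]
      linarith [ih r hr]
  | @edge u v z a c he h ih =>
    intro l hl
    have : (I.stackerCrane i M).edgeWeight s(u, v) = I.dist u v := rfl
    rw [this]
    linarith [I.routeLen_triangle z u v l, ih l hl]

theorem optLen_le_of_isTour {i : Fin k} {M : Finset (Fin m)} {c : ℝ}
    (h : (I.stackerCrane i M).IsTour (I.start i) c) :
    I.optLen (I.start i) M (I.start i) ≤ c := by
  classical
  obtain ⟨a, ha, hall⟩ := h
  -- A tour may repeat arcs; one occurrence of each is kept, which gives an order of the whole set.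
  have h1 := I.routeLen_le_of_walk ha (a.map Subtype.val).dedup (List.dedup_sublist _)
  have h2 := I.optLen_le_routeLen (I.start i) (I.start i) _ (List.nodup_dedup (a.map Subtype.val))
  have h3 : (a.map Subtype.val).dedup.toFinset = M := by
    ext j
    simp only [List.mem_toFinset, List.mem_dedup, List.mem_map]
    exact ⟨fun ⟨b, _, hb⟩ => hb ▸ b.2, fun hj => ⟨⟨j, hj⟩, hall _, rfl⟩⟩
  rw [h3] at h2
  exact h2.trans h1

theorem optLen_nonneg (p u : Fin n) (M : Finset (Fin m)) : 0 ≤ I.optLen p M u := by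
  obtain ⟨l, hl⟩ := I.exists_isGreedy p u M
  rw [← hl.routeLen_eq]
  exact I.routeLen_nonneg p u l

end Instance

/-- The rule that chooses optimal tours. -/
noncomputable def optTourRule : TourRule := fun I i M =>
  (I.exists_isGreedy (I.start i) (I.start i) M).choose

namespace Instance

variable {n m k : ℕ} (I : Instance n m k)

theorem optTourRule_isGreedy (i : Fin k) (M : Finset (Fin m)) :
    I.IsGreedy (I.start i) (I.start i) M (optTourRule I i M) :=
  (I.exists_isGreedy (I.start i) (I.start i) M).choose_spec

theorem tourLen_optTourRule (i : Fin k) (M : Finset (Fin m)) :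
    I.tourLen i (optTourRule I i M) = I.optLen (I.start i) M (I.start i) :=
  (I.optTourRule_isGreedy i M).routeLen_eq

/-- The chosen round trip is at most as long as every tour, and lengths are nonnegative, so the
factor 9/5 costs nothing. -/
theorem optTourRule_isTourApprox (i : Fin k) (M : Finset (Fin m)) :
    I.IsTourApprox (9 / 5) i M (optTourRule I i M) := by
  have h := (I.optTourRule_isGreedy i M).nodup_toFinset
  refine ⟨h.1, h.2, fun c hc => ?_⟩
  rw [I.tourLen_optTourRule]
  linarith [I.optLen_le_of_isTour hc, I.optLen_nonneg (I.start i) (I.start i) M]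

theorem planCost_optTourRule (w : Fin k → ℝ) (f : Fin m → Fin k) :
    I.planCost w (optTourRule.plan I f) =
      ∑ i, w i * I.optLen (I.start i) (Finset.univ.filter fun j => f j = i) (I.start i) := by
  simp only [planCost, TourRule.plan, tourLen_optTourRule]

end Instance

/-! ### Pickups and drops in a schedule -/

namespace Schedule

variable {n m k : ℕ}

@[simp] theorem order_nil (i : Fin k) : order ([] : Schedule n m k) i = [] := rfl

@[simp] theorem order_move (x : Schedule n m k) (a i : Fin k) (v : Fin n) :
    order (.move a v :: x) i = order x i := rfl

@[simp] theorem order_drop (x : Schedule n m k) (a i : Fin k) (j : Fin m) :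
    order (.drop a j :: x) i = order x i := rfl

theorem order_pickup (x : Schedule n m k) (a i : Fin k) (j : Fin m) :
    order (.pickup a j :: x) i = if a = i then j :: order x i else order x i := by
  by_cases h : a = i <;> simp [order, h]

theorem order_append (x y : Schedule n m k) (i : Fin k) :
    order (x ++ y) i = order x i ++ order y i := by
  simp [order]

theorem mem_order_iff (x : Schedule n m k) (i : Fin k) (j : Fin m) :
    j ∈ order x i ↔ Event.pickup i j ∈ x := by
  induction x with
  | nil => simp
  | cons e x ih =>
    cases e with
    | move a v => simp [ih]
    | drop a v => simp [ih]
    | pickup a j' =>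
      rw [order_pickup]
      by_cases h : a = i
      · subst h; simp [ih]
      · simp [ih, h, Ne.symm h]

@[simp] theorem dropCount_nil (j : Fin m) : dropCount ([] : Schedule n m k) j = 0 := rfl

@[simp] theorem dropCount_move (x : Schedule n m k) (a : Fin k) (v : Fin n) (j : Fin m) :
    dropCount (.move a v :: x) j = dropCount x j := by simp [dropCount]

@[simp] theorem dropCount_pickup (x : Schedule n m k) (a : Fin k) (j' j : Fin m) :
    dropCount (.pickup a j' :: x) j = dropCount x j := by simp [dropCount]

theorem dropCount_drop (x : Schedule n m k) (a : Fin k) (j' j : Fin m) :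
    dropCount (.drop a j' :: x) j = dropCount x j + if j' = j then 1 else 0 := by
  simp [dropCount, List.countP_cons]

theorem dropCount_append (x y : Schedule n m k) (j : Fin m) :
    dropCount (x ++ y) j = dropCount x j + dropCount y j := by
  simp [dropCount]

end Schedule

/-- The carried packages lie at no node and have only one carrier. -/
structure State.Consistent {n m k : ℕ} (s : State n m k) : Prop where
  loc_eq_none : ∀ {i j}, s.load i = some j → s.loc j = none
  load_inj : ∀ {i i' j}, s.load i = some j → s.load i' = some j → i = i'

/-! ### Lower bound for the travel distances in a solution -/

namespace Instance

variable {n m k : ℕ} {I : Instance n m k}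

theorem init_consistent : I.init.Consistent := ⟨by simp [init], by simp [init]⟩

theorem Step.consistent {s s' : State n m k} {e : Event n m k} (h : I.Step s e s')
    (hs : s.Consistent) : s'.Consistent := by
  cases h with
  | move i v h => exact ⟨hs.loc_eq_none, hs.load_inj⟩
  | pickup i j hfree hloc =>
    have hne : ∀ {a}, s.load a = some j → False := fun ha => by
      rw [hs.loc_eq_none ha] at hloc; cases hloc
    constructor
    · intro a j' ha
      simp only [Function.update_apply] at ha ⊢
      by_cases h2 : j' = j
      · rw [if_pos h2]
      · rw [if_neg h2]
        split_ifs at ha with h1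
        · cases ha; exact absurd rfl h2
        · exact hs.loc_eq_none ha
    · intro a a' j' ha ha'
      simp only [Function.update_apply] at ha ha'
      split_ifs at ha ha' with h1 h2 h2
      · rw [h1, h2]
      · cases ha; exact (hne ha').elim
      · cases ha'; exact (hne ha).elim
      · exact hs.load_inj ha ha'
  | drop i j hload =>
    constructor
    · intro a j' ha
      simp only [Function.update_apply] at ha ⊢
      split_ifs at ha with h1
      have h2 : j' ≠ j := fun h => h1 (hs.load_inj (h ▸ ha) hload)
      rw [if_neg h2]
      exact hs.loc_eq_none ha
    · intro a a' j' ha ha'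
      simp only [Function.update_apply] at ha ha'
      split_ifs at ha ha'
      exact hs.load_inj ha ha'

theorem Step.unique {s s₁ s₂ : State n m k} {e : Event n m k} (h₁ : I.Step s e s₁)
    (h₂ : I.Step s e s₂) : s₁ = s₂ := by
  cases h₁ <;> cases h₂ <;> rfl

theorem Run.unique {s s₁ s₂ : State n m k} {x : Schedule n m k} (h₁ : I.Run s x s₁)
    (h₂ : I.Run s x s₂) : s₁ = s₂ := by
  induction h₁ with
  | nil => cases h₂; rfl
  | cons h _ ih =>
    cases h₂ with
    | cons h' hx' =>
      obtain rfl := h.unique h'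
      exact ih hx'

theorem Run.append {s s₁ s₂ : State n m k} {x y : Schedule n m k} (h₁ : I.Run s x s₁)
    (h₂ : I.Run s₁ y s₂) : I.Run s (x ++ y) s₂ := by
  induction h₁ with
  | nil => exact h₂
  | cons h _ ih => exact .cons h (ih h₂)

theorem Run.travelFrom_append {s s₁ : State n m k} {x : Schedule n m k} (h : I.Run s x s₁)
    (y : Schedule n m k) (i : Fin k) :
    I.travelFrom i s.pos (x ++ y) = I.travelFrom i s.pos x + I.travelFrom i s₁.pos y := by
  induction h with
  | nil => simp [travelFrom]
  | cons h _ ih =>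
    cases h with
    | move a v h => simp only [List.cons_append, travelFrom, ih]; ring
    | pickup a j _ _ => exact ih
    | drop a j _ => exact ih

/-- A package that lies at a node at the end and is not dropped any more lies there already. -/
theorem Run.loc_eq_of_dropCount {s s' : State n m k} {x : Schedule n m k} (h : I.Run s x s')
    {j : Fin m} {v : Fin n} (hd : x.dropCount j = 0) (hv : s'.loc j = some v) :
    s.loc j = some v := by
  induction h with
  | nil => exact hv
  | cons h _ ih =>
    cases h with
    | move a v h => exact ih (by simpa using hd) hv
    | pickup a j' _ _ =>
      have := ih (by simpa using hd) hv
      simp only [Function.update_apply] at this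
      split_ifs at this
      exact this
    | drop a j' _ =>
      rw [Schedule.dropCount_drop] at hd
      have := ih (by omega) hv
      simp only [Function.update_apply] at this
      split_ifs at this with h1
      · simp [h1] at hd
      · exact this

/-- The number of times package `j` is picked up by agent `i` is at most the number of times it is
dropped, if it lies at a node at first. -/
theorem Run.count_order_le {s s' : State n m k} {x : Schedule n m k} (h : I.Run s x s')
    (hs : s.Consistent) {j : Fin m} (hj : s'.loc j ≠ none) (i : Fin k) :
    (x.order i).count j + (if s.loc j = none then 1 else 0) ≤ x.dropCount j := by
  -- The second summand on the left counts the drop that is still owed while the package is being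
  -- carried.
  induction h with
  | nil => simp [hj]
  | cons h _ ih =>
    have hs₁ := h.consistent hs
    cases h with
    | move a v h => simpa using ih hs₁ hj
    | pickup a j' _ hloc =>
      have := ih hs₁ hj
      rw [Schedule.dropCount_pickup, Schedule.order_pickup]
      simp only [Function.update_apply] at this
      by_cases hjj : j = j'
      · subst hjj
        simp only [if_true] at this
        rw [hloc]
        split_ifs <;> simp at * <;> omega
      · simp only [hjj, if_false] at this
        split_ifs at this ⊢ <;> simp_all [Ne.symm hjj]
    | drop a j' hload =>
      have := ih hs₁ hj
      rw [Schedule.dropCount_drop, Schedule.order_drop]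
      simp only [Function.update_apply] at this
      have hn := hs.loc_eq_none hload
      by_cases hjj : j = j'
      · subst hjj
        simp at this
        simp [hn, this]
      · simp only [hjj, if_false] at this
        simpa [Ne.symm hjj] using this

/-- An agent travels at least the length of the shortest round trip for the order in which it picks
up its packages, if the packages are delivered directly. -/
theorem Run.routeLen_le_travelFrom {s s' : State n m k} {x : Schedule n m k} (h : I.Run s x s')
    (hs : s.Consistent) (hend : ∀ j, s'.loc j = some (I.tgt j)) (hdrop : ∀ j, x.dropCount j ≤ 1)
    (hsrc : ∀ j v, s.loc j = some v → x.dropCount j ≠ 0 → v = I.src j) (i : Fin k) :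
    (s.load i).elim (I.routeLen (s'.pos i) (s.pos i) (x.order i))
      (fun j => I.dist (s.pos i) (I.tgt j) + I.routeLen (s'.pos i) (I.tgt j) (x.order i)) ≤
      I.travelFrom i s.pos x := by
  -- Going backwards through the schedule: a loaded agent must still reach the target of its package
  -- before the remaining round trip. The hypothesis on sources says that a package lying at a node
  -- and still to be dropped has not been moved yet.
  induction h with
  | nil s =>
    cases hl : s.load i with
    | none => simp [routeLen, travelFrom]
    | some j =>
      have := hs.loc_eq_none hl
      rw [hend j] at this
      cases this
  | @cons s s₁ s₂ e x h hx ih =>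
    have hs₁ := h.consistent hs
    cases h with
    | move a v hadj =>
      have ih := ih hs₁ hend (by simpa using hdrop) (by simpa using hsrc)
      simp only [travelFrom, Schedule.order_move]
      by_cases hai : a = i
      · subst hai
        simp only [Function.update_self, if_true] at ih ⊢
        have hd := I.dist_le_len hadj
        cases hl : s.load a with
        | none =>
          rw [hl] at ih
          simp only [Option.elim] at ih ⊢
          linarith [I.routeLen_triangle (s₂.pos a) (s.pos a) v (x.order a)]
        | some j =>
          rw [hl] at ih
          simp only [Option.elim] at ih ⊢
          linarith [I.dist_triangle (s.pos a) v (I.tgt j)]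
      · simpa [hai, Function.update_of_ne (Ne.symm hai)] using ih
    | pickup a j hfree hloc =>
      -- A carried package must still be dropped, since it lies at its target in the end; hence this
      -- pickup is at its source.
      have hd1 : x.dropCount j ≠ 0 := fun h0 => by
        have := hx.loc_eq_of_dropCount h0 (hend j)
        simp at this
      have hpos : s.pos a = I.src j := hsrc j _ hloc (by simpa using hd1)
      have ih := ih hs₁ hend (by simpa using hdrop) (by
        intro j' v hv hd
        simp only [Function.update_apply] at hv
        split_ifs at hv
        exact hsrc j' v hv (by simpa using hd))
      simp only [travelFrom, Schedule.order_pickup]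
      by_cases hai : a = i
      · subst hai
        simp only [Function.update_self, if_true, hfree, Option.elim, routeLen] at ih ⊢
        rw [hpos] at ih ⊢
        simpa using ih
      · simpa [hai, Function.update_of_ne (Ne.symm hai)] using ih
    | drop a j hload =>
      have hdj := hdrop j
      rw [Schedule.dropCount_drop, if_pos rfl] at hdj
      -- With at most one drop per package, this drop is the last one, so it takes place at the
      -- target.
      have hd0 : x.dropCount j = 0 := by omega
      have hpos : s.pos a = I.tgt j := by
        have := hx.loc_eq_of_dropCount hd0 (hend j)
        simpa using this
      have ih := ih hs₁ hend (fun j' => by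
          have := hdrop j'
          rw [Schedule.dropCount_drop] at this
          omega) (by
        intro j' v hv hd
        simp only [Function.update_apply] at hv
        split_ifs at hv with h1
        · subst h1; exact absurd hd0 hd
        · exact hsrc j' v hv (by rw [Schedule.dropCount_drop]; omega))
      simp only [travelFrom, Schedule.order_drop]
      by_cases hai : a = i
      · subst hai
        simp only [Function.update_self, Option.elim, hload] at ih ⊢
        rw [hpos] at ih ⊢
        simpa using ih
      · simpa [hai, Function.update_of_ne (Ne.symm hai)] using ih

/-- Every solution in `directReturn` splits the packages among the agents, and is at least as long
as the corresponding round trips. -/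
theorem exists_assignment_of_directReturn {x : Schedule n m k} (hx : x ∈ I.directReturn) :
    ∃ f : Fin m → Fin k, ∀ i, (x.order i).Nodup ∧
      (x.order i).toFinset = Finset.univ.filter (fun j => f j = i) ∧
      I.tourLen i (x.order i) ≤ I.travel x i := by
  obtain ⟨⟨⟨s, hrun, hend⟩, huniq⟩, hdrop, s', hrun', hpos⟩ := hx
  -- Execution is deterministic, so the final state with all deliveries is the one with all agents
  -- back at their starts.
  obtain rfl := hrun.unique hrun'
  choose f hf hfu using huniq
  refine ⟨f, fun i => ⟨?_, ?_, ?_⟩⟩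
  -- Every pickup is followed by a drop of its own, and each package is dropped only once.
  · refine List.nodup_iff_count_le_one.2 fun j => ?_
    have := hrun.count_order_le init_consistent (j := j) (by simp [hend j]) i
    rw [hdrop j] at this
    omega
  · ext j
    simp only [List.mem_toFinset, Schedule.mem_order_iff, Finset.mem_filter, Finset.mem_univ,
      true_and]
    exact ⟨fun h => (hfu j i h).symm, fun h => h ▸ hf j⟩
  · have := hrun.routeLen_le_travelFrom init_consistent hend (fun j => (hdrop j).le)
      (fun j v hv _ => by simpa [init, eq_comm] using hv) i
    rw [hpos i] at this
    simpa [init, tourLen, travel] using this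

/-! ## Schedules that execute a plan -/

/-- A schedule of agent `i` alone from state `s` to state `s'`, with its pickups and distance. -/
structure Trip (I : Instance n m k) (i : Fin k) (s s' : State n m k) (x : Schedule n m k)
    (l : List (Fin m)) (c : ℝ) : Prop where
  run : I.Run s x s'
  order : x.order i = l
  order_of_ne : ∀ a, a ≠ i → x.order a = []
  dropCount : ∀ j, x.dropCount j = l.count j
  travel : I.travelFrom i s.pos x = c
  travel_of_ne : ∀ a, a ≠ i → I.travelFrom a s.pos x = 0

theorem Trip.append {i : Fin k} {s s₁ s₂ : State n m k} {x y : Schedule n m k}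
    {l l' : List (Fin m)} {c c' : ℝ} (h : I.Trip i s s₁ x l c) (h' : I.Trip i s₁ s₂ y l' c') :
    I.Trip i s s₂ (x ++ y) (l ++ l') (c + c') where
  run := h.run.append h'.run
  order := by rw [Schedule.order_append, h.order, h'.order]
  order_of_ne a ha := by rw [Schedule.order_append, h.order_of_ne a ha, h'.order_of_ne a ha]; rfl
  dropCount j := by rw [Schedule.dropCount_append, h.dropCount, h'.dropCount, List.count_append]
  travel := by rw [h.run.travelFrom_append, h.travel, h'.travel]
  travel_of_ne a ha := by
    rw [h.run.travelFrom_append, h.travel_of_ne a ha, h'.travel_of_ne a ha, add_zero]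

theorem exists_trip_of_walk (i : Fin k) {u v : Fin n} (p : I.graph.Walk u v) (s : State n m k)
    (hs : s.pos i = u) :
    ∃ x, I.Trip i s { s with pos := Function.update s.pos i v } x [] (I.walkLen p) := by
  induction p generalizing s with
  | nil =>
    refine ⟨[], ?_, rfl, fun _ _ => rfl, fun _ => rfl, by simp [travelFrom], fun _ _ => rfl⟩
    rw [← hs, Function.update_eq_self]
    exact .nil s
  | @cons u v z h p ih =>
    subst hs
    obtain ⟨x, hx⟩ := ih { s with pos := Function.update s.pos i v } (by simp)
    have hr := hx.run
    simp only [Function.update_idem] at hr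
    refine ⟨.move i v :: x, .cons (.move s i v h) hr, by simpa using hx.order,
      fun a ha => by simpa using hx.order_of_ne a ha, fun j => by simpa using hx.dropCount j, ?_, ?_⟩
    · simpa [travelFrom] using hx.travel
    · intro a ha
      simpa [travelFrom, Ne.symm ha] using hx.travel_of_ne a ha

theorem exists_trip_dist (i : Fin k) (s : State n m k) (v : Fin n) :
    ∃ x, I.Trip i s { s with pos := Function.update s.pos i v } x [] (I.dist (s.pos i) v) := by
  obtain ⟨p, -, hp⟩ := I.exists_isPath_walkLen_eq_dist (s.pos i) v
  rw [← hp]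
  exact exists_trip_of_walk i p s rfl

/-- For each package in turn: a shortest path to the source, the pickup, a shortest path to the
target, the drop. The explicit final state allows trips of different agents to be concatenated. -/
theorem exists_trip_route (i : Fin k) (p : Fin n) (l : List (Fin m)) (s : State n m k)
    (hload : s.load i = none) (hloc : ∀ j ∈ l, s.loc j = some (I.src j)) (hl : l.Nodup) :
    ∃ x, I.Trip i s
      { s with pos := Function.update s.pos i p,
               loc := fun j => if j ∈ l then some (I.tgt j) else s.loc j } x l
      (I.routeLen p (s.pos i) l) := by
  induction l generalizing s with
  | nil => simpa [routeLen] using exists_trip_dist i s p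
  | cons j l ih =>
    rw [List.nodup_cons] at hl
    obtain ⟨x₁, h₁⟩ := exists_trip_dist (I := I) i s (I.src j)
    set s₁ : State n m k := { s with pos := Function.update s.pos i (I.src j) } with hs₁
    let s₂ : State n m k :=
      { s₁ with load := Function.update s₁.load i (some j), loc := Function.update s₁.loc j none }
    obtain ⟨x₃, h₃⟩ := exists_trip_dist (I := I) i s₂ (I.tgt j)
    set s₃ : State n m k := { s₂ with pos := Function.update s₂.pos i (I.tgt j) } with hs₃
    let s₄ : State n m k :=
      { s₃ with load := Function.update s₃.load i none,
                loc := Function.update s₃.loc j (some (s₃.pos i)) }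
    have hstep₂ : I.Step s₁ (.pickup i j) s₂ :=
      .pickup s₁ i j hload (by simp [s₁, hloc j])
    have hstep₄ : I.Step s₃ (.drop i j) s₄ := .drop s₃ i j (by simp [s₃, s₂])
    have h₂₄ : I.Trip i s₁ s₄ (.pickup i j :: x₃ ++ [.drop i j]) [j]
        (I.dist (I.src j) (I.tgt j)) := by
      refine ⟨.append (.cons hstep₂ h₃.run) (.cons hstep₄ (.nil _)), ?_, ?_, ?_, ?_, ?_⟩
      · simp [Schedule.order_append, Schedule.order_pickup, h₃.order]
      · intro a ha
        simp [Schedule.order_append, Schedule.order_pickup, h₃.order_of_ne a ha, Ne.symm ha]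
      · intro j'
        rw [Schedule.dropCount_append, Schedule.dropCount_drop, Schedule.dropCount_pickup,
          h₃.dropCount]
        simp [List.count_cons]
      · rw [(Run.cons hstep₂ h₃.run).travelFrom_append]
        have := h₃.travel
        simp only [travelFrom]
        simpa [s₂, s₁] using this
      · intro a ha
        rw [(Run.cons hstep₂ h₃.run).travelFrom_append]
        have := h₃.travel_of_ne a ha
        simp only [travelFrom]
        simpa [s₂, s₁] using this
    obtain ⟨x₅, h₅⟩ := ih s₄ (by simp [s₄]) (by
      intro j' hj'
      have hne : j' ≠ j := fun h => hl.1 (h ▸ hj')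
      simp [s₄, s₃, s₂, s₁, Function.update_of_ne hne, hloc j' (List.mem_cons_of_mem _ hj')]) hl.2
    have h := (h₁.append h₂₄).append h₅
    refine ⟨x₁ ++ (.pickup i j :: x₃ ++ [.drop i j]) ++ x₅, ?_⟩
    convert h using 1
    · simp only [s₄, s₃, s₂, s₁, Function.update_idem, State.mk.injEq, true_and]
      refine ⟨?_, ?_⟩
      · rw [← hload, Function.update_eq_self]
      · funext j'
        by_cases h1 : j' = j
        · subst h1; simp [hl.1]
        · simp [h1]
    · simp
    · have : s₄.pos i = I.tgt j := by simp [s₄, s₃]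
      rw [routeLen, this]

/-- Every plan that splits the packages among the agents is executed by a schedule. -/
theorem exists_executes (L : I.Plan) (f : Fin m → Fin k) (hL : ∀ i, (L i).Nodup)
    (hf : ∀ i j, j ∈ L i ↔ f j = i) : ∃ x, I.Executes x L := by
  classical
  -- The agents work one after the other; `a` lists those that are finished. Their packages are at
  -- the targets, all others still at the sources, so the next agent is not disturbed.
  have key : ∀ a : List (Fin k), a.Nodup → ∃ x,
      I.Run I.init x ⟨I.start, fun _ => none,
        fun j => if f j ∈ a then some (I.tgt j) else some (I.src j)⟩ ∧
      (∀ i, x.order i = if i ∈ a then L i else []) ∧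
      (∀ j, x.dropCount j = if f j ∈ a then 1 else 0) ∧
      ∀ i, I.travel x i = if i ∈ a then I.tourLen i (L i) else 0 := by
    intro a ha
    induction a with
    | nil => exact ⟨[], by simpa [init] using Run.nil I.init, by simp, by simp, by simp [travel, travelFrom]⟩
    | cons b a ih =>
      rw [List.nodup_cons] at ha
      obtain ⟨x, hrun, hord, hdrop, htravel⟩ := ih ha.2
      obtain ⟨y, hy⟩ := exists_trip_route (I := I) b (I.start b) (L b)
        ⟨I.start, fun _ => none, fun j => if f j ∈ a then some (I.tgt j) else some (I.src j)⟩ rfl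
        (by
          intro j hj
          have : f j ∉ a := by rw [(hf b j).1 hj]; exact ha.1
          show (if f j ∈ a then some (I.tgt j) else some (I.src j)) = _
          rw [if_neg this]) (hL b)
      refine ⟨x ++ y, ?_, fun i => ?_, fun j => ?_, fun i => ?_⟩
      · convert hrun.append hy.run using 1
        simp only [Function.update_eq_self, State.mk.injEq, true_and]
        funext j
        by_cases h1 : f j = b <;> simp [hf, h1]
      · rw [Schedule.order_append, hord]
        by_cases h1 : i = b
        · subst h1; simp [ha.1, hy.order]
        · simp [h1, hy.order_of_ne i h1]
      · rw [Schedule.dropCount_append, hdrop, hy.dropCount]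
        by_cases h1 : f j = b
        · have : (L b).count j = 1 := List.count_eq_one_of_mem (hL b) ((hf b j).2 h1)
          simp [h1, ha.1, this]
        · have : (L b).count j = 0 := List.count_eq_zero.2 fun h => h1 ((hf b j).1 h)
          simp [h1, this]
      · have h0 := htravel i
        rw [travel] at h0 ⊢
        have := hrun.travelFrom_append y i
        rw [show I.init.pos = I.start from rfl] at this
        rw [this, h0]
        by_cases h1 : i = b
        · subst h1
          simpa [ha.1, tourLen] using hy.travel
        · simpa [h1] using hy.travel_of_ne i h1
  obtain ⟨x, hrun, hord, hdrop, htravel⟩ := key (List.finRange k) (List.nodup_finRange k)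
  simp only [List.mem_finRange, if_true] at hrun hord hdrop htravel
  refine ⟨x, ⟨⟨⟨_, hrun, fun j => rfl⟩, fun j => ?_⟩, hdrop, _, hrun, fun i => rfl⟩,
    fun i => ⟨hord i, htravel i⟩⟩
  simp only [← Schedule.mem_order_iff, hord, hf]
  exact ⟨f j, rfl, fun _ h => h.symm⟩

/-! ## Optimality of the best plan -/

theorem Executes.cost_eq {S : Schedule n m k} {L : I.Plan} (h : I.Executes S L) (w : Fin k → ℝ) :
    I.cost w S = I.planCost w L := by
  simp only [cost, planCost, (h.2 _).2]

theorem planCost_nonneg {w : Fin k → ℝ} (hw : ∀ i, 0 ≤ w i) (L : I.Plan) : 0 ≤ I.planCost w L :=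
  Finset.sum_nonneg fun i _ => mul_nonneg (hw i) (I.routeLen_nonneg _ _ _)

theorem exists_executes_optTourRule (f : Fin m → Fin k) :
    ∃ S, I.Executes S (optTourRule.plan I f) := by
  refine exists_executes _ f (fun i => (I.optTourRule_isGreedy i _).nodup_toFinset.1) fun i j => ?_
  rw [TourRule.plan, ← List.mem_toFinset, (I.optTourRule_isGreedy i _).nodup_toFinset.2]
  simp

/-- A cheapest plan of optimal tours is a cheapest solution in `directReturn`. -/
theorem isLeast_planCost {w : Fin k → ℝ} (hw : ∀ i, 0 ≤ w i) {L : I.Plan}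
    (hL : L ∈ optTourRule.plans I) (hmin : ∀ L' ∈ optTourRule.plans I, I.planCost w L ≤ I.planCost w L') :
    IsLeast (I.cost w '' I.directReturn) (I.planCost w L) := by
  obtain ⟨f, rfl⟩ := hL
  obtain ⟨S, hS⟩ := I.exists_executes_optTourRule f
  refine ⟨⟨S, hS.1, hS.cost_eq w⟩, ?_⟩
  rintro _ ⟨x, hx, rfl⟩
  obtain ⟨g, hg⟩ := exists_assignment_of_directReturn hx
  -- The solution is compared with the plan for its own assignment `g`, agent by agent;
  -- nonnegativity of the weights is needed here.
  refine (hmin _ ⟨g, rfl⟩).trans (Finset.sum_le_sum fun i _ => mul_le_mul_of_nonneg_left ?_ (hw i))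
  rw [TourRule.plan, tourLen_optTourRule, ← (hg i).2.1]
  exact (I.optLen_le_routeLen _ _ _ (hg i).1).trans (hg i).2.2

end Instance

/-! ## Verification of programs -/

namespace Store

theorem nat_setNat_self (s : Store) (a i j x i' j' : ℕ) :
    (s.setNat a i j x).nat a i' j' = if i' = i ∧ j' = j then x else s.nat a i' j' := by
  simp [setNat]

theorem nat_setNat_of_ne (s : Store) {a a' : ℕ} (h : a' ≠ a) (i j x : ℕ) :
    (s.setNat a i j x).nat a' = s.nat a' := by
  funext i' j'
  simp [setNat, h]

@[simp] theorem real_setNat (s : Store) (a i j x : ℕ) : (s.setNat a i j x).real = s.real := rfl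

theorem real_setReal_self (s : Store) (a i j : ℕ) (x : ℝ) (i' j' : ℕ) :
    (s.setReal a i j x).real a i' j' = if i' = i ∧ j' = j then x else s.real a i' j' := by
  simp [setReal]

theorem real_setReal_of_ne (s : Store) {a a' : ℕ} (h : a' ≠ a) (i j : ℕ) (x : ℝ) :
    (s.setReal a i j x).real a' = s.real a' := by
  funext i' j'
  simp [setReal, h]

@[simp] theorem nat_setReal (s : Store) (a i j : ℕ) (x : ℝ) :
    (s.setReal a i j x).nat = s.nat := rfl

end Store

namespace Program

/-- The program may change the `a`-th array of natural numbers. -/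
def writesNat (a : ℕ) : Program → Bool
  | skip => false
  | setNat b _ _ _ => a == b
  | setReal _ _ _ _ => false
  | seq P Q => P.writesNat a || Q.writesNat a
  | ite _ P Q => P.writesNat a || Q.writesNat a
  | loop _ P => P.writesNat a

/-- The program may change the `a`-th array of real numbers. -/
def writesReal (a : ℕ) : Program → Bool
  | skip => false
  | setNat _ _ _ _ => false
  | setReal b _ _ _ => a == b
  | seq P Q => P.writesReal a || Q.writesReal a
  | ite _ P Q => P.writesReal a || Q.writesReal a
  | loop _ P => P.writesReal a

/-- The arrays that the program does not write to are the same in both memories. -/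
structure Frame (P : Program) (s s' : Store) : Prop where
  nat : ∀ a, P.writesNat a = false → s'.nat a = s.nat a
  real : ∀ a, P.writesReal a = false → s'.real a = s.real a

theorem Frame.refl (P : Program) (s : Store) : P.Frame s s := ⟨fun _ _ => rfl, fun _ _ => rfl⟩

theorem Frame.trans {P : Program} {s₁ s₂ s₃ : Store} (h : P.Frame s₁ s₂) (h' : P.Frame s₂ s₃) :
    P.Frame s₁ s₃ :=
  ⟨fun a ha => (h'.nat a ha).trans (h.nat a ha), fun a ha => (h'.real a ha).trans (h.real a ha)⟩

theorem Frame.mono {P Q : Program} {s s' : Store} (h : P.Frame s s')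
    (hn : ∀ a, Q.writesNat a = false → P.writesNat a = false)
    (hr : ∀ a, Q.writesReal a = false → P.writesReal a = false) : Q.Frame s s' :=
  ⟨fun a ha => h.nat a (hn a ha), fun a ha => h.real a (hr a ha)⟩

/-- Whether an array may be written is decided by evaluating a Boolean on the syntax, so
preservation of an array is later discharged by `rfl`. -/
theorem Exec.frame {P : Program} {s s' : Store} {t : ℕ} (h : P.Exec s s' t) : P.Frame s s' := by
  induction h with
  | skip s => exact .refl _ s
  | setNat s a i j e =>
    exact ⟨fun b hb => s.nat_setNat_of_ne (by simpa [writesNat] using hb) _ _ _, fun _ _ => rfl⟩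
  | setReal s a i j e =>
    exact ⟨fun _ _ => rfl, fun b hb => s.real_setReal_of_ne (by simpa [writesReal] using hb) _ _ _⟩
  | seq _ _ ihP ihQ =>
    exact (ihP.mono (by simp +contextual [writesNat]) (by simp +contextual [writesReal])).trans
      (ihQ.mono (by simp +contextual [writesNat]) (by simp +contextual [writesReal]))
  | iteTrue _ _ ih =>
    exact ih.mono (by simp +contextual [writesNat]) (by simp +contextual [writesReal])
  | iteFalse _ _ ih =>
    exact ih.mono (by simp +contextual [writesNat]) (by simp +contextual [writesReal])
  | loopTrue _ _ _ ihP ihL =>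
    exact (ihP.mono (by simp [writesNat]) (by simp [writesReal])).trans ihL
  | loopFalse _ => exact .refl _ _

end Program

/-! ### Running time and nesting depth of loops -/

/-- The expression is one of the sizes `n`, `m`, `k` in the input. -/
def NExp.isInputSize : NExp → Bool
  | .get 0 _ _ => true
  | _ => false

/-- The test compares with one of the sizes in the input. -/
def BExp.isShort : BExp → Bool
  | .natLe _ e => e.isInputSize
  | _ => false

namespace Program

/-- A bound for the running time, if loops whose test compares with an input size are executed at
most `q` times, and all other loops at most `R` times. -/
def time (q R : ℕ) : Program → ℕ
  | skip => 1
  | setNat _ i j e => 1 + i.size + j.size + e.size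
  | setReal _ i j e => 1 + i.size + j.size + e.size
  | seq P Q => P.time q R + Q.time q R
  | ite b P Q => 1 + b.size + (P.time q R + Q.time q R)
  | loop b P => ((if b.isShort then q else R) + 1) * (1 + b.size + P.time q R)

/-- Nesting depth of the loops whose test does not compare with an input size. -/
def depth : Program → ℕ
  | skip => 0
  | setNat _ _ _ _ => 0
  | setReal _ _ _ _ => 0
  | seq P Q => max P.depth Q.depth
  | ite _ P Q => max P.depth Q.depth
  | loop b P => (if b.isShort then 0 else 1) + P.depth

/-- Each short loop contributes a factor of order `q`, each level of long loops a factor of order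
`R`. The constants are chosen before `q` and `R`, hence are the same for all inputs. -/
theorem exists_time_le (P : Program) :
    ∃ C D, ∀ q R, 1 ≤ q → 1 ≤ R → P.time q R ≤ C * q ^ D * R ^ P.depth := by
  induction P with
  | skip => exact ⟨1, 0, fun q R _ _ => by simp [time, depth]⟩
  | setNat a i j e => exact ⟨_, 0, fun q R _ _ => by simp only [time, depth, pow_zero, mul_one]; exact le_rfl⟩
  | setReal a i j e => exact ⟨_, 0, fun q R _ _ => by simp only [time, depth, pow_zero, mul_one]; exact le_rfl⟩
  | seq P Q ihP ihQ =>
    obtain ⟨C, D, h⟩ := ihP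
    obtain ⟨C', D', h'⟩ := ihQ
    refine ⟨C + C', max D D', fun q R hq hR => ?_⟩
    simp only [time, depth, add_mul]
    refine add_le_add ((h q R hq hR).trans ?_) ((h' q R hq hR).trans ?_)
    · gcongr
      exacts [le_max_left _ _, le_max_left _ _]
    · gcongr
      exacts [le_max_right _ _, le_max_right _ _]
  | ite b P Q ihP ihQ =>
    obtain ⟨C, D, h⟩ := ihP
    obtain ⟨C', D', h'⟩ := ihQ
    refine ⟨(1 + b.size) + (C + C'), max D D', fun q R hq hR => ?_⟩
    simp only [time, depth, add_mul]
    refine add_le_add ?_ (add_le_add ((h q R hq hR).trans ?_) ((h' q R hq hR).trans ?_))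
    · rw [← add_mul, ← add_mul, mul_assoc]
      exact Nat.le_mul_of_pos_right _ (by positivity)
    · gcongr
      exacts [le_max_left _ _, le_max_left _ _]
    · gcongr
      exacts [le_max_right _ _, le_max_right _ _]
  | loop b P ih =>
    obtain ⟨C, D, h⟩ := ih
    refine ⟨2 * (1 + b.size + C), D + 1, fun q R hq hR => ?_⟩
    have hbody : 1 + b.size + P.time q R ≤ (1 + b.size + C) * (q ^ D * R ^ P.depth) := by
      rw [add_mul]
      refine add_le_add (Nat.le_mul_of_pos_right _ (by positivity)) ?_
      rw [← mul_assoc]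
      exact h q R hq hR
    -- The additional one accounts for the final failing test; it is absorbed into the factor 2, as
    -- `q` and `R` are positive.
    have hiter : (if b.isShort then q else R) + 1 ≤ 2 * (q * R ^ (if b.isShort then 0 else 1)) := by
      split_ifs
      · simp; omega
      · have := Nat.le_mul_of_pos_left R hq
        simp; omega
    calc _ ≤ (2 * (q * R ^ (if b.isShort then 0 else 1))) *
          ((1 + b.size + C) * (q ^ D * R ^ P.depth)) := Nat.mul_le_mul hiter hbody
      _ = _ := by rw [depth, pow_add R, pow_succ q]; ring

/-- Started in memory `s`, the program halts within its time bound, in a memory that satisfies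
`Q`. -/
def Ends (q R : ℕ) (P : Program) (s : Store) (Q : Store → Prop) : Prop :=
  ∃ s' t, P.Exec s s' t ∧ t ≤ P.time q R ∧ Q s'

variable {q R : ℕ} {P P' : Program} {s : Store} {Q Q' : Store → Prop}

/-- The frame is supplied along with the postcondition, so postconditions need not mention untouched
arrays. -/
theorem Ends.imp (h : P.Ends q R s Q) (hQ : ∀ s', P.Frame s s' → Q s' → Q' s') :
    P.Ends q R s Q' := by
  obtain ⟨s', t, he, ht, h⟩ := h
  exact ⟨s', t, he, ht, hQ s' he.frame h⟩

theorem Ends.skip (h : Q s) : Program.skip.Ends q R s Q := ⟨s, 1, .skip s, le_rfl, h⟩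

theorem Ends.setNat {a : ℕ} {i j e : NExp} (h : Q (s.setNat a (i.eval s) (j.eval s) (e.eval s))) :
    (Program.setNat a i j e).Ends q R s Q := ⟨_, _, .setNat s a i j e, le_rfl, h⟩

theorem Ends.setReal {a : ℕ} {i j : NExp} {e : RExp}
    (h : Q (s.setReal a (i.eval s) (j.eval s) (e.eval s))) :
    (Program.setReal a i j e).Ends q R s Q := ⟨_, _, .setReal s a i j e, le_rfl, h⟩

theorem Ends.seq (h : P.Ends q R s fun s' => P'.Ends q R s' Q) : (P.seq P').Ends q R s Q := by
  obtain ⟨s₁, t₁, he₁, ht₁, s₂, t₂, he₂, ht₂, h⟩ := h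
  exact ⟨s₂, _, .seq he₁ he₂, add_le_add ht₁ ht₂, h⟩

theorem Ends.andThen (h : P.Ends q R s Q) (h' : ∀ s', P.Frame s s' → Q s' → P'.Ends q R s' Q') :
    (P.seq P').Ends q R s Q' := .seq (h.imp h')

theorem Ends.ite {b : BExp} (h : b.holds s → P.Ends q R s Q) (h' : ¬ b.holds s → P'.Ends q R s Q) :
    (Program.ite b P P').Ends q R s Q := by
  by_cases hb : b.holds s
  · obtain ⟨s₁, t₁, he, ht, h⟩ := h hb
    exact ⟨s₁, _, .iteTrue hb he, by simp only [time]; omega, h⟩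
  · obtain ⟨s₁, t₁, he, ht, h⟩ := h' hb
    exact ⟨s₁, _, .iteFalse hb he, by simp only [time]; omega, h⟩

end Program

/-! ### Counting loops and their invariant rule -/

/-- The content of cell `(0, 0)` of the `a`-th array. -/
abbrev NExp.var (a : ℕ) : NExp := .get a (.const 0) (.const 0)

/-- The content of cell `(i, 0)` of the `a`-th array. -/
abbrev NExp.arr (a : ℕ) (i : NExp) : NExp := .get a i (.const 0)

/-- The content of cell `(0, 0)` of the `a`-th array of real numbers. -/
abbrev RExp.var (a : ℕ) : RExp := .get a (.const 0) (.const 0)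

namespace Program

/-- Assignment to cell `(0, 0)` of the `a`-th array. -/
abbrev setVar (a : ℕ) (e : NExp) : Program := .setNat a (.const 0) (.const 0) e

/-- Assignment to cell `(0, 0)` of the `a`-th array of real numbers. -/
abbrev setRealVar (a : ℕ) (e : RExp) : Program := .setReal a (.const 0) (.const 0) e

/-- `forLoop x e P` executes `P` for all values less than `e` of the counter `x`. -/
def forLoop (x : ℕ) (e : NExp) (P : Program) : Program :=
  .seq (setVar x (.const 0))
    (.loop (.natLe (.add (.var x) (.const 1)) e)
      (.seq P (setVar x (.add (.var x) (.const 1)))))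

variable {q R : ℕ} {P : Program} {Q : Store → Prop}

/-- Invariant rule. The invariant is required after the counter has been increased, because the
increment belongs to the loop body; the bound must keep its value in every memory that the loop can
reach. -/
theorem Ends.forLoop {x N : ℕ} {e : NExp} {s₀ : Store} (Inv : ℕ → Store → Prop)
    (hN : N ≤ if e.isInputSize then q else R)
    (he : ∀ s, (forLoop x e P).Frame s₀ s → e.eval s = N)
    (h0 : Inv 0 (s₀.setNat x 0 0 0))
    (hstep : ∀ c s, c < N → (Program.forLoop x e P).Frame s₀ s → s.nat x 0 0 = c → Inv c s →
      P.Ends q R s fun s' => s'.nat x 0 0 = c ∧ Inv (c + 1) (s'.setNat x 0 0 (c + 1)))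
    (hQ : ∀ s, (Program.forLoop x e P).Frame s₀ s → Inv N s → Q s) :
    (Program.forLoop x e P).Ends q R s₀ Q := by
  -- Induction on the number `d` of remaining iterations, with one further test for leaving the
  -- loop.
  have key : ∀ d c s, c + d = N → (Program.forLoop x e P).Frame s₀ s → s.nat x 0 0 = c → Inv c s →
      ∃ s' t, (Program.loop (.natLe (.add (.var x) (.const 1)) e)
        (.seq P (setVar x (.add (.var x) (.const 1))))).Exec s s' t ∧
        t ≤ d * (1 + (BExp.natLe (.add (.var x) (.const 1)) e).size +
          (Program.seq P (setVar x (.add (.var x) (.const 1)))).time q R) +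
          (1 + (BExp.natLe (.add (.var x) (.const 1)) e).size) ∧
        (Program.forLoop x e P).Frame s₀ s' ∧ Inv N s' := by
    intro d
    induction d with
    | zero =>
      intro c s hc hf hx hI
      have hb : ¬ (BExp.natLe (.add (.var x) (.const 1)) e).holds s := by
        simp only [BExp.holds, NExp.eval, hx, he s hf]; omega
      exact ⟨s, _, .loopFalse hb, by omega, hf, by rwa [← hc, add_zero]⟩
    | succ d ih =>
      intro c s hc hf hx hI
      have hb : (BExp.natLe (.add (.var x) (.const 1)) e).holds s := by
        simp only [BExp.holds, NExp.eval, hx, he s hf]; omega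
      obtain ⟨s₁, t₁, he₁, ht₁, hx₁, hI₁⟩ := hstep c s (by omega) hf hx hI
      have hbody := Exec.seq he₁ (Exec.setNat s₁ x (.const 0) (.const 0) (.add (.var x) (.const 1)))
      have hs₂ : s₁.setNat x ((NExp.const 0).eval s₁) ((NExp.const 0).eval s₁)
          ((NExp.add (.var x) (.const 1)).eval s₁) = s₁.setNat x 0 0 (c + 1) := by
        simp only [NExp.eval, hx₁]
      rw [hs₂] at hbody
      obtain ⟨s₃, t₃, he₃, ht₃, hf₃, hI₃⟩ := ih (c + 1) _ (by omega)
        (hf.trans (hbody.frame.mono (by simp [Program.forLoop, writesNat])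
          (by simp [Program.forLoop, writesReal]))) (by simp [Store.nat_setNat_self]) hI₁
      refine ⟨s₃, _, .loopTrue hb hbody he₃, ?_, hf₃, hI₃⟩
      simp only [time] at ht₃ ⊢
      rw [Nat.succ_mul]
      omega
  have hset := Exec.setNat s₀ x (.const 0) (.const 0) (.const 0)
  obtain ⟨s', t, hex, ht, hf, hI⟩ := key N 0 _ (by omega)
    (hset.frame.mono (by simp +contextual [Program.forLoop, writesNat])
      (by simp [Program.forLoop, writesReal])) (by simp [Store.nat_setNat_self, NExp.eval]) h0
  refine ⟨s', _, .seq hset hex, ?_, hQ s' hf hI⟩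
  refine add_le_add le_rfl (ht.trans ?_)
  change _ ≤ ((if e.isInputSize then q else R) + 1) * _
  have := Nat.mul_le_mul_right (1 + (BExp.natLe (.add (.var x) (.const 1)) e).size +
    (Program.seq P (setVar x (.add (.var x) (.const 1)))).time q R) hN
  rw [add_mul, one_mul]
  simp only [time] at this ⊢
  omega

theorem Ends.forFin {x N : ℕ} {e : NExp} {s₀ : Store} (Inv : ℕ → Store → Prop)
    (hx : P.writesNat x = false) (hN : N ≤ if e.isInputSize then q else R)
    (he : ∀ s, (Program.forLoop x e P).Frame s₀ s → e.eval s = N)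
    (h0 : Inv 0 (s₀.setNat x 0 0 0))
    (hstep : ∀ (c : Fin N) s, (Program.forLoop x e P).Frame s₀ s → s.nat x 0 0 = c → Inv c s →
      P.Ends q R s fun s' => Inv (c + 1) (s'.setNat x 0 0 (c + 1)))
    (hQ : ∀ s, (Program.forLoop x e P).Frame s₀ s → Inv N s → Q s) :
    (Program.forLoop x e P).Ends q R s₀ Q :=
  .forLoop Inv hN he h0 (fun c s hc hf hxs hI => (hstep ⟨c, hc⟩ s hf hxs hI).imp
    fun s' hf' hI' => ⟨by rw [hf'.nat x hx, hxs], hI'⟩) hQ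

end Program

-- Preservation of the input

attribute [simp] NExp.eval RExp.eval BExp.holds Store.nat_setNat_self Store.nat_setNat_of_ne
  Store.real_setReal_self Store.real_setReal_of_ne

/-- The arrays that hold the input have their initial contents. -/
structure Store.HasInput (s : Store) {n m k : ℕ} (I : Instance n m k) (w : Fin k → ℝ) : Prop where
  nodes : s.nat 0 0 0 = n
  packages : s.nat 0 0 1 = m
  agents : s.nat 0 0 2 = k
  adj_iff : ∀ u v : Fin n, 1 ≤ s.nat 1 u v ↔ I.graph.Adj u v
  start : ∀ i : Fin k, s.nat 2 i 0 = I.start i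
  src : ∀ j : Fin m, s.nat 3 j 0 = I.src j
  tgt : ∀ j : Fin m, s.nat 4 j 0 = I.tgt j
  len : ∀ u v : Fin n, s.real 0 u v = I.edgeLen u v
  weight : ∀ i : Fin k, s.real 1 i 0 = w i

/-- The program does not change the input. -/
def Program.keepsInput (P : Program) : Bool :=
  !(P.writesNat 0 || P.writesNat 1 || P.writesNat 2 || P.writesNat 3 || P.writesNat 4 ||
    P.writesReal 0 || P.writesReal 1)

section

variable {n m k : ℕ} {I : Instance n m k} {w : Fin k → ℝ}

theorem Instance.hasInput_input : (I.input w).HasInput I w where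
  nodes := rfl
  packages := rfl
  agents := rfl
  adj_iff u v := by
    by_cases h : I.graph.Adj u v <;> simp [input, pad, h]
  start i := by simp [input, pad]
  src j := by simp [input, pad]
  tgt j := by simp [input, pad]
  len u v := by simp [input, pad, edgeLen]
  weight i := by simp [input, pad]

theorem Store.HasInput.frame {P : Program} {s s' : Store} (h : s.HasInput I w) (hf : P.Frame s s')
    (hP : P.keepsInput = true) : s'.HasInput I w := by
  simp only [Program.keepsInput, Bool.not_eq_true', Bool.or_eq_false_iff] at hP
  obtain ⟨⟨⟨⟨⟨⟨h0, h1⟩, h2⟩, h3⟩, h4⟩, h5⟩, h6⟩ := hP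
  constructor
  · rw [hf.nat 0 h0]; exact h.nodes
  · rw [hf.nat 0 h0]; exact h.packages
  · rw [hf.nat 0 h0]; exact h.agents
  · rw [hf.nat 1 h1]; exact h.adj_iff
  · rw [hf.nat 2 h2]; exact h.start
  · rw [hf.nat 3 h3]; exact h.src
  · rw [hf.nat 4 h4]; exact h.tgt
  · rw [hf.real 0 h5]; exact h.len
  · rw [hf.real 1 h6]; exact h.weight

/-- The number of nodes in the input. -/
abbrev NExp.nodes : NExp := .get 0 (.const 0) (.const 0)
/-- The number of packages in the input. -/
abbrev NExp.packages : NExp := .get 0 (.const 0) (.const 1)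
/-- The number of agents in the input. -/
abbrev NExp.agents : NExp := .get 0 (.const 0) (.const 2)

/-! ### Invariants for partial sums and for Floyd–Warshall -/

theorem sum_ite_lt_succ (g : Fin n → ℝ) (u : Fin n) :
    (∑ x : Fin n, if (x : ℕ) < u + 1 then g x else 0) =
      (∑ x : Fin n, if (x : ℕ) < u then g x else 0) + g u := by
  have h : g u = ∑ x : Fin n, if x = u then g x else 0 := by simp
  rw [h, ← Finset.sum_add_distrib]
  refine Finset.sum_congr rfl fun x _ => ?_
  by_cases hx : x = u
  · simp [hx]
  · have : (x : ℕ) ≠ u := fun h => hx (Fin.ext h)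
    simp only [hx, if_false, add_zero]
    exact if_congr (by omega) rfl rfl

theorem forall_lt_succ_iff {p : Fin n → Prop} (u : Fin n) :
    (∀ x : Fin n, (x : ℕ) < u + 1 → p x) ↔ (∀ x : Fin n, (x : ℕ) < u → p x) ∧ p u := by
  refine ⟨fun h => ⟨fun x hx => h x (by omega), h u (by omega)⟩, fun h x hx => ?_⟩
  rcases Nat.lt_succ_iff_lt_or_eq.1 hx with h' | h'
  · exact h.1 x h'
  · rw [Fin.ext h']; exact h.2

/-- State of the algorithm of Floyd and Warshall after the nodes less than `c` have been
considered. -/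
structure Instance.IsPartialDist (I : Instance n m k) (c : ℕ) (D : Fin n → Fin n → ℝ) : Prop where
  dist_le : ∀ u v, I.dist u v ≤ D u v
  self : ∀ u, D u u = 0
  le_len : ∀ u v, I.graph.Adj u v → D u v ≤ I.len s(u, v)
  triangle : ∀ z : Fin n, (z : ℕ) < c → ∀ u v, D u v ≤ D u z + D z v

/-- Triangle inequalities through the nodes already treated replace the usual statement about paths
with restricted inner nodes. Allowing `z` preserves the old inequalities and adds those through `z`,
because the diagonal is zero. -/
theorem Instance.IsPartialDist.succ {D : Fin n → Fin n → ℝ} {z : Fin n}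
    (h : I.IsPartialDist z D) :
    I.IsPartialDist (z + 1) fun u v => min (D u v) (D u z + D z v) := by
  have h0 : ∀ u v, 0 ≤ D u v := fun u v => (I.dist_nonneg u v).trans (h.dist_le u v)
  refine ⟨fun u v => le_min (h.dist_le u v) ?_, fun u => ?_, fun u v huv => ?_, ?_⟩
  · linarith [I.dist_triangle u z v, h.dist_le u z, h.dist_le z v]
  · rw [h.self]
    exact min_eq_left (add_nonneg (h0 _ _) (h0 _ _))
  · exact (min_le_left _ _).trans (h.le_len u v huv)
  · refine (forall_lt_succ_iff z).2 ⟨fun y hy u v => ?_, fun u v => ?_⟩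
    -- If both entries on the right already pass through `z`, the closed detour from `z` to `y` and
    -- back is dropped; it is nonnegative. The other cases use a triangle inequality through `y`.
    · have h1 := h.triangle y hy u v
      have h2 := h.triangle y hy z v
      have h3 := h.triangle y hy u z
      have h4 := h0 y z
      have h5 := h0 z y
      rcases min_cases (D u v) (D u z + D z v) with ⟨e1, _⟩ | ⟨e1, _⟩ <;>
      rcases min_cases (D u y) (D u z + D z y) with ⟨e2, _⟩ | ⟨e2, _⟩ <;>
      rcases min_cases (D y v) (D y z + D z v) with ⟨e3, _⟩ | ⟨e3, _⟩ <;>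
      rw [e1, e2, e3] <;> linarith
    · simp [h.self]

theorem Instance.IsPartialDist.eq_dist {D : Fin n → Fin n → ℝ} (h : I.IsPartialDist n D)
    (u v : Fin n) : D u v = I.dist u v :=
  le_antisymm (I.le_dist_of_triangle D h.self h.le_len (fun u v z => h.triangle v v.2 u z) u v)
    (h.dist_le u v)

namespace Program

/-! ## Computation of the distances -/

/-- The sum of all edge lengths. -/
def sumLengths : Program :=
  .seq (setRealVar 5 .zero) (forLoop 11 .nodes (forLoop 12 .nodes
    (setRealVar 5 (.add (.var 5) (.get 0 (.var 11) (.var 12))))))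

/-- The sum replaces infinity in the initial matrix: no distance exceeds it, by `dist_le_sum`. -/
theorem sumLengths_ends {q R : ℕ} {s : Store} (hs : s.HasInput I w) (hn : n ≤ q) :
    sumLengths.Ends q R s fun s' => s'.real 5 0 0 = ∑ u, ∑ v, I.edgeLen u v := by
  refine .seq (.setReal ?_)
  have hs := hs.frame (Exec.setReal s 5 (.const 0) (.const 0) .zero).frame rfl
  refine .forFin (fun c s => s.real 5 0 0 =
    ∑ u : Fin n, if (u : ℕ) < c then ∑ v, I.edgeLen u v else 0) rfl hn
    (fun s' hf => (hs.frame hf rfl).nodes) (by simp) (fun u s₁ hf hx hI => ?_)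
    (fun s' _ hI => by simpa using hI)
  have hs₁ := hs.frame hf rfl
  refine .forFin (fun d s => s.real 5 0 0 = s₁.real 5 0 0 +
    ∑ v : Fin n, if (v : ℕ) < d then I.edgeLen u v else 0) rfl hn
    (fun s' hf => (hs₁.frame hf rfl).nodes) (by simp) (fun v s₂ hf₂ hy hI₂ => ?_)
    (fun s' _ hI' => ?_)
  · have hx₂ : s₂.nat 11 0 0 = u := by rw [hf₂.nat 11 rfl, hx]
    refine .setReal ?_
    rw [sum_ite_lt_succ]
    simp [hy, hx₂, (hs₁.frame hf₂ rfl).len, hI₂, add_assoc]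
  · rw [sum_ite_lt_succ]
    simpa [hI] using hI'

/-- The initial upper bounds for the distances. -/
def initDist : Program :=
  forLoop 11 .nodes (forLoop 12 .nodes
    (ite (.and (.natLe (.var 11) (.var 12)) (.natLe (.var 12) (.var 11)))
      (setReal 2 (.var 11) (.var 12) .zero)
      (ite (.natLe (.const 1) (.get 1 (.var 11) (.var 12)))
        (setReal 2 (.var 11) (.var 12) (.get 0 (.var 11) (.var 12)))
        (setReal 2 (.var 11) (.var 12) (.var 5)))))

theorem initDist_ends {q R : ℕ} {s : Store} (hs : s.HasInput I w) (hn : n ≤ q)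
    (hB : s.real 5 0 0 = ∑ u, ∑ v, I.edgeLen u v) :
    initDist.Ends q R s fun s' => I.IsPartialDist 0 fun u v => s'.real 2 u v := by
  let ok (s : Store) (u v : Fin n) : Prop := I.dist u v ≤ s.real 2 u v ∧
    (u = v → s.real 2 u v = 0) ∧ (I.graph.Adj u v → s.real 2 u v ≤ I.len s(u, v))
  refine .forFin (fun c s => ∀ u : Fin n, (u : ℕ) < c → ∀ v, ok s u v) rfl hn
    (fun s' hf => (hs.frame hf rfl).nodes) (by simp) (fun u s₁ hf hx hI => ?_)
    (fun s' _ hI => ⟨fun u v => (hI u u.2 v).1, fun u => (hI u u.2 u).2.1 rfl,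
      fun u v => (hI u u.2 v).2.2, by simp⟩)
  have hs₁ := hs.frame hf rfl
  refine .forFin (fun d s => (∀ x : Fin n, (x : ℕ) < u → ∀ v, ok s x v) ∧
      ∀ v : Fin n, (v : ℕ) < d → ok s u v) rfl hn
    (fun s' hf => (hs₁.frame hf rfl).nodes) ⟨hI, by simp⟩ (fun v s₂ hf₂ hy hI₂ => ?_)
    (fun s' _ hI' => (forall_lt_succ_iff u).2 ⟨hI'.1, fun v => hI'.2 v v.2⟩)
  have hx₂ : s₂.nat 11 0 0 = u := by rw [hf₂.nat 11 rfl, hx]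
  have hs₂ := hs₁.frame hf₂ rfl
  have hB₂ : s₂.real 5 0 0 = ∑ u, ∑ v, I.edgeLen u v := by rw [hf₂.real 5 rfl, hf.real 5 rfl, hB]
  -- The three branches of the program differ only in the value written, so the invariant is reduced
  -- to three conditions on that value.
  have key : ∀ y : ℝ, I.dist u v ≤ y → (u = v → y = 0) → (I.graph.Adj u v → y ≤ I.len s(u, v)) →
      ((∀ x : Fin n, (x : ℕ) < u → ∀ z : Fin n, ok (s₂.setReal 2 u v y) x z) ∧
        ∀ z : Fin n, (z : ℕ) < v + 1 → ok (s₂.setReal 2 u v y) u z) := by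
    intro y h1 h2 h3
    have hne : ∀ a b : Fin n, (a, b) ≠ (u, v) → ok s₂ a b → ok (s₂.setReal 2 u v y) a b := by
      intro a b hab h
      have : ¬ ((a : ℕ) = u ∧ (b : ℕ) = v) := fun h => hab (Prod.ext (Fin.ext h.1) (Fin.ext h.2))
      simpa [ok, this] using h
    refine ⟨fun x hx z => hne x z ?_ (hI₂.1 x hx z), (forall_lt_succ_iff v).2
      ⟨fun z hz => hne u z ?_ (hI₂.2 z hz), ?_⟩⟩
    · rintro ⟨⟩; omega
    · rintro ⟨⟩; omega
    · simpa [ok] using ⟨h1, h2, h3⟩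
  refine .ite (fun hb => .setReal ?_) fun hb => .ite (fun hadj => .setReal ?_) fun hadj => .setReal ?_
  all_goals simp only [BExp.holds, NExp.eval, RExp.eval, hx₂, hy, hs₂.len, hs₂.adj_iff, hB₂] at *
  · obtain rfl : u = v := Fin.ext (by omega)
    exact key 0 (by simp) (by simp) (by simp)
  · refine key _ ?_ (fun h => absurd hadj (by simp [h])) ?_
    · simpa [Instance.edgeLen, hadj] using I.dist_le_len hadj
    · simp [Instance.edgeLen, hadj]
  · exact key _ (I.dist_le_sum u v) (fun h => absurd (by rw [h]; simp) hb) (fun h => absurd h hadj)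

/-- The algorithm of Floyd and Warshall. -/
def floydWarshall : Program :=
  forLoop 13 .nodes (forLoop 11 .nodes (forLoop 12 .nodes
    (ite (.realLe (.add (.get 2 (.var 11) (.var 13)) (.get 2 (.var 13) (.var 12)))
        (.get 2 (.var 11) (.var 12)))
      (setReal 2 (.var 11) (.var 12)
        (.add (.get 2 (.var 11) (.var 13)) (.get 2 (.var 13) (.var 12))))
      skip)))

theorem floydWarshall_ends {q R : ℕ} {s : Store} (hs : s.HasInput I w) (hn : n ≤ q)
    (h0 : I.IsPartialDist 0 fun u v => s.real 2 u v) :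
    floydWarshall.Ends q R s fun s' => ∀ u v : Fin n, s'.real 2 u v = I.dist u v := by
  refine .forFin (fun c s => I.IsPartialDist c fun u v => s.real 2 u v) rfl hn
    (fun s' hf => (hs.frame hf rfl).nodes) (by simpa using h0) (fun z s₁ hf₁ hz hI₁ => ?_)
    (fun s' _ hI => hI.eq_dist)
  have hs₁ := hs.frame hf₁ rfl
  set D : Fin n → Fin n → ℝ := fun u v => s₁.real 2 u v with hD
  have hself : ∀ u, D u u = 0 := hI₁.self
  let D' : Fin n → Fin n → ℝ := fun u v => min (D u v) (D u z + D z v)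
  -- Row and column `z` do not change during round `z`, so updating the matrix in place is harmless.
  have hz1 : ∀ u, D' u z = D u z := fun u => by simp [D', hself]
  have hz2 : ∀ v, D' z v = D z v := fun v => by simp [D', hself]
  refine .forFin (fun c s => ∀ x y : Fin n, s.real 2 x y = if (x : ℕ) < c then D' x y else D x y)
    rfl hn (fun s' hf => (hs₁.frame hf rfl).nodes) (by simp [hD]) (fun u s₂ hf₂ hu hI₂ => ?_)
    (fun s' _ hI => ?_)
  · have hs₂ := hs₁.frame hf₂ rfl
    refine .forFin (fun d s => ∀ x y : Fin n, s.real 2 x y =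
      if (x : ℕ) < u ∨ (x : ℕ) = u ∧ (y : ℕ) < d then D' x y else D x y)
      rfl hn (fun s' hf => (hs₂.frame hf rfl).nodes) (by simpa using hI₂) (fun v s₃ hf₃ hv hI₃ => ?_)
      (fun s' _ hI => ?_)
    · have hu₃ : s₃.nat 11 0 0 = u := by rw [hf₃.nat 11 rfl, hu]
      have hz₃ : s₃.nat 13 0 0 = z := by rw [hf₃.nat 13 rfl, hf₂.nat 13 rfl, hz]
      have e1 : s₃.real 2 u z = D u z := by rw [hI₃, hz1, ite_self]
      have e2 : s₃.real 2 z v = D z v := by rw [hI₃, hz2, ite_self]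
      have e3 : s₃.real 2 u v = D u v := by rw [hI₃, if_neg (by omega)]
      have hnew : ∀ x y : Fin n, ¬ ((x : ℕ) = u ∧ (y : ℕ) = v) → s₃.real 2 x y =
          if (x : ℕ) < u ∨ (x : ℕ) = u ∧ (y : ℕ) < v + 1 then D' x y else D x y := by
        intro x y hxy
        rw [hI₃]
        exact if_congr (by omega) rfl rfl
      refine .ite (fun hb => .setReal fun x y => ?_) fun hb => .skip fun x y => ?_
      all_goals simp only [BExp.holds, NExp.eval, RExp.eval, hu₃, hz₃, hv, e1, e2, e3] at hb ⊢
      · by_cases hxy : (x : ℕ) = u ∧ (y : ℕ) = v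
        · obtain ⟨rfl, rfl⟩ : x = u ∧ y = v := ⟨Fin.ext hxy.1, Fin.ext hxy.2⟩
          simp [D', min_eq_right hb]
        · simpa [hxy] using hnew x y hxy
      · by_cases hxy : (x : ℕ) = u ∧ (y : ℕ) = v
        · obtain ⟨rfl, rfl⟩ : x = u ∧ y = v := ⟨Fin.ext hxy.1, Fin.ext hxy.2⟩
          simpa [D', min_eq_left (not_le.1 hb).le] using e3
        · simpa using hnew x y hxy
    · intro x y
      simp only [Store.real_setNat, hI]
      exact if_congr (by omega) rfl rfl
  · have : (fun u v : Fin n => (s'.setNat 13 0 0 (z + 1)).real 2 u v) = D' := by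
      funext x y
      simp [hI]
    rw [this]
    exact hI₁.succ

/-- All distances. -/
def distances : Program := .seq sumLengths (.seq initDist floydWarshall)

theorem distances_ends {q R : ℕ} {s : Store} (hs : s.HasInput I w) (hn : n ≤ q) :
    distances.Ends q R s fun s' => ∀ u v : Fin n, s'.real 2 u v = I.dist u v :=
  .seq <| (sumLengths_ends hs hn).imp fun _ hf₁ h₁ => .seq <|
    (initDist_ends (hs.frame hf₁ rfl) hn h₁).imp fun _ hf₂ h₂ =>
      floydWarshall_ends ((hs.frame hf₁ rfl).frame hf₂ rfl) hn h₂

end Program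

end

/-! ## Codes of sets of packages -/

/-- The binary code of a set of packages. -/
def setCode {m : ℕ} (M : Finset (Fin m)) : ℕ := ∑ j ∈ M, 2 ^ (j : ℕ)

section

variable {n m k : ℕ} {I : Instance n m k} {w : Fin k → ℝ}

theorem setCode_eq_sum_map (M : Finset (Fin m)) :
    setCode M = ∑ j ∈ M.map Fin.valEmbedding, 2 ^ j := by
  simp [setCode]

@[simp] theorem setCode_empty : setCode (∅ : Finset (Fin m)) = 0 := rfl

/-- Erasing a package subtracts a power of two, so the sets needed by the Bellman recursion have
smaller codes. -/
theorem setCode_erase_add {M : Finset (Fin m)} {j : Fin m} (hj : j ∈ M) :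
    setCode (M.erase j) + 2 ^ (j : ℕ) = setCode M := Finset.sum_erase_add _ _ hj

theorem setCode_lt_of_forall_lt {M : Finset (Fin m)} {t : ℕ} (h : ∀ j ∈ M, (j : ℕ) < t) :
    setCode M < 2 ^ t := by
  rw [setCode_eq_sum_map]
  exact Nat.geomSum_lt le_rfl (by simpa using fun j hj => h j hj)

theorem setCode_lt (M : Finset (Fin m)) : setCode M < 2 ^ m :=
  setCode_lt_of_forall_lt fun j _ => j.2

theorem setCode_injective : Function.Injective (setCode (m := m)) := by
  intro M M' h
  rw [setCode_eq_sum_map, setCode_eq_sum_map] at h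
  exact Finset.map_injective _ (Finset.geomSum_injective le_rfl h)

/-- There are as many sets as numbers below `2 ^ m`, and the code is injective; thus a loop counter
can be read as a set. -/
theorem exists_setCode_eq {S : ℕ} (hS : S < 2 ^ m) : ∃ M : Finset (Fin m), setCode M = S := by
  have hb : Function.Bijective fun M : Finset (Fin m) => (⟨setCode M, setCode_lt M⟩ : Fin (2 ^ m)) :=
    (Fintype.bijective_iff_injective_and_card _).2
      ⟨fun M M' h => setCode_injective (Fin.mk.inj h), by simp⟩
  obtain ⟨M, hM⟩ := hb.2 ⟨S, hS⟩
  exact ⟨M, congrArg Fin.val hM⟩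

/-- The memory contains the powers of two and a table of the elements of all sets of packages. -/
structure Store.HasSets (s : Store) (m : ℕ) : Prop where
  pow : ∀ j, j ≤ m → s.nat 7 j 0 = 2 ^ j
  mem : ∀ (M : Finset (Fin m)) (j : Fin m), s.nat 8 (setCode M) j = if j ∈ M then 1 else 0

theorem Store.HasSets.frame {P : Program} {s s' : Store} (h : s.HasSets m) (hf : P.Frame s s')
    (h7 : P.writesNat 7 = false) (h8 : P.writesNat 8 = false) : s'.HasSets m :=
  ⟨by rw [hf.nat 7 h7]; exact h.pow, by rw [hf.nat 8 h8]; exact h.mem⟩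

namespace Program

/-- Computation of the powers of two and of the binary codes. -/
def sets : Program :=
  .seq (setVar 7 (.const 1)) (forLoop 14 .packages
    (.seq (forLoop 15 (.arr 7 (.var 14))
        (.seq (forLoop 16 .packages
            (setNat 8 (.add (.arr 7 (.var 14)) (.var 15)) (.var 16) (.get 8 (.var 15) (.var 16))))
          (setNat 8 (.add (.arr 7 (.var 14)) (.var 15)) (.var 14) (.const 1))))
      (setNat 7 (.add (.var 14) (.const 1)) (.const 0)
        (.add (.arr 7 (.var 14)) (.arr 7 (.var 14))))))

/-- The table doubles with each package `t`: rows from `2 ^ t` on are copies of the rows below, with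
`t` added. Only the row of the empty set relies on memory being zero at first. -/
theorem sets_ends {q R : ℕ} {s : Store} (hs : s.HasInput I w) (hm : m ≤ q) (hR : 2 ^ m ≤ R)
    (h0 : ∀ j, s.nat 8 0 j = 0) : sets.Ends q R s fun s' => s'.HasSets m := by
  refine Ends.andThen (Q := fun s' => s'.nat 7 0 0 = 1) (.setNat (by simp)) fun s₀ hf₀ h₀ => ?_
  have hs₀ := hs.frame hf₀ rfl
  rw [← hf₀.nat 8 rfl] at h0
  clear hf₀ hs s
  refine .forFin (fun t s => (∀ j, j ≤ t → s.nat 7 j 0 = 2 ^ j) ∧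
    ∀ M : Finset (Fin m), (∀ j ∈ M, (j : ℕ) < t) → ∀ j : Fin m,
      s.nat 8 (setCode M) j = if j ∈ M then 1 else 0) rfl hm
    (fun s' hf => (hs₀.frame hf rfl).packages) ⟨?_, ?_⟩ (fun t s₁ hf₁ ht hI₁ => ?_)
    (fun s' _ hI => ⟨hI.1, fun M => hI.2 M fun j _ => j.2⟩)
  · intro j hj
    obtain rfl : j = 0 := by omega
    simpa using h₀
  · intro M hM j
    have : M = ∅ := Finset.eq_empty_of_forall_notMem fun j hj => absurd (hM j hj) (by omega)
    subst this
    simpa using h0 j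
  · have hs₁ := hs₀.frame hf₁ rfl
    have hpow : s₁.nat 7 t 0 = 2 ^ (t : ℕ) := hI₁.1 t le_rfl
    have hle : 2 ^ (t : ℕ) ≤ 2 ^ m := Nat.pow_le_pow_right (by norm_num) t.2.le
    refine Ends.andThen (Q := fun s => (∀ r : ℕ, r < 2 ^ (t : ℕ) → s.nat 8 r = s₁.nat 8 r) ∧
      ∀ r : ℕ, r < 2 ^ (t : ℕ) → ∀ j : Fin m,
        s.nat 8 (2 ^ (t : ℕ) + r) j = if j = t then 1 else s₁.nat 8 r j) ?_ ?_
    · refine .forFin (N := 2 ^ (t : ℕ)) (fun c s => (∀ r : ℕ, r < 2 ^ (t : ℕ) → s.nat 8 r = s₁.nat 8 r) ∧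
        ∀ r : ℕ, r < c → ∀ j : Fin m,
          s.nat 8 (2 ^ (t : ℕ) + r) j = if j = t then 1 else s₁.nat 8 r j) rfl (hle.trans hR)
        (fun s' hf => by simp [hf.nat 7 rfl, hf.nat 14 rfl, ht, hpow]) (by simp)
        (fun c s₂ hf₂ hc hI₂ => ?_) (fun s' _ hI => hI)
      have hs₂ := hs₁.frame hf₂ rfl
      have ht₂ : s₂.nat 14 0 0 = t := by rw [hf₂.nat 14 rfl, ht]
      have hpow₂ : s₂.nat 7 t 0 = 2 ^ (t : ℕ) := by rw [hf₂.nat 7 rfl, hpow]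
      refine Ends.andThen (Q := fun s => (∀ r : ℕ, r ≠ 2 ^ (t : ℕ) + c → s.nat 8 r = s₂.nat 8 r) ∧
        ∀ j : Fin m, s.nat 8 (2 ^ (t : ℕ) + c) j = s₁.nat 8 c j) ?_ ?_
      · refine .forFin (fun d s => (∀ r : ℕ, r ≠ 2 ^ (t : ℕ) + c → s.nat 8 r = s₂.nat 8 r) ∧
          ∀ j : Fin m, (j : ℕ) < d → s.nat 8 (2 ^ (t : ℕ) + c) j = s₁.nat 8 c j) rfl hm
          (fun s' hf => (hs₂.frame hf rfl).packages) (by simp) (fun j s₃ hf₃ hj hI₃ => .setNat ?_)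
          (fun s' _ hI => ⟨hI.1, fun j => hI.2 j j.2⟩)
        have ht₃ : s₃.nat 14 0 0 = t := by rw [hf₃.nat 14 rfl, ht₂]
        have hc₃ : s₃.nat 15 0 0 = c := by rw [hf₃.nat 15 rfl, hc]
        have hpow₃ : s₃.nat 7 t 0 = 2 ^ (t : ℕ) := by rw [hf₃.nat 7 rfl, hpow₂]
        have hold : s₃.nat 8 c = s₁.nat 8 c := by
          rw [hI₃.1 c (by have := Nat.two_pow_pos t; omega), hI₂.1 c c.2]
        refine ⟨fun r hr => ?_, (forall_lt_succ_iff j).2 ⟨fun x hx => ?_, ?_⟩⟩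
        · funext i
          simp [ht₃, hc₃, hpow₃, hr, hI₃.1 r hr]
        · simpa [ht₃, hc₃, hpow₃, hj, hx.ne, hold] using hI₃.2 x hx
        · simp [ht₃, hc₃, hpow₃, hj, hold]
      · intro s₃ hf₃ hI₃
        have ht₃ : s₃.nat 14 0 0 = t := by rw [hf₃.nat 14 rfl, ht₂]
        have hc₃ : s₃.nat 15 0 0 = c := by rw [hf₃.nat 15 rfl, hc]
        have hpow₃ : s₃.nat 7 t 0 = 2 ^ (t : ℕ) := by rw [hf₃.nat 7 rfl, hpow₂]
        refine .setNat ⟨fun r hr => ?_, (fun r hr j => ?_)⟩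
        · have : r ≠ 2 ^ (t : ℕ) + c := by omega
          funext i
          simp [ht₃, hc₃, hpow₃, this, hI₃.1 r this, hI₂.1 r hr]
        · by_cases hrc : r = c
          · subst hrc
            simp [ht₃, hc₃, hpow₃, hI₃.2, Fin.ext_iff]
          · simp [ht₃, hc₃, hpow₃, hrc, hI₃.1 (2 ^ (t : ℕ) + r) (by omega), hI₂.2 r (by omega) j]
    · intro s₂ hf₂ hI₂
      have ht₂ : s₂.nat 14 0 0 = t := by rw [hf₂.nat 14 rfl, ht]
      refine .setNat ⟨fun j hj => ?_, fun M hM j => ?_⟩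
      · rcases Nat.lt_or_ge (t : ℕ) j with h | h
        · obtain rfl : j = t + 1 := by omega
          simp [ht₂, hf₂.nat 7 rfl, hpow, pow_succ, mul_two]
        · have : j ≠ t + 1 := by omega
          simp [ht₂, this, hf₂.nat 7 rfl, hI₁.1 j h]
      · simp only [NExp.eval, ne_eq, Nat.reduceEqDiff, not_false_eq_true, Store.nat_setNat_of_ne]
        by_cases htM : t ∈ M
        · have hM' : ∀ x ∈ M.erase t, (x : ℕ) < t := fun x hx => by
            have h1 := hM x (Finset.mem_of_mem_erase hx)
            have h2 : (x : ℕ) ≠ t := fun h => Finset.ne_of_mem_erase hx (Fin.ext h)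
            omega
          -- A set that contains `t` has the copied row, whose original belongs to the set without
          -- `t`.
          rw [← setCode_erase_add htM, add_comm, hI₂.2 _ (setCode_lt_of_forall_lt hM'), hI₁.2 _ hM']
          by_cases hjt : j = t
          · simp [hjt, htM]
          · simp [hjt]
        · have hM' : ∀ x ∈ M, (x : ℕ) < t := fun x hx => by
            have h1 := hM x hx
            have h2 : (x : ℕ) ≠ t := fun h => htM (Fin.ext h ▸ hx)
            omega
          rw [hI₂.1 _ (setCode_lt_of_forall_lt hM'), hI₁.2 _ hM']

end Program

end

section

variable {n m k : ℕ} {I : Instance n m k} {w : Fin k → ℝ}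

/-! ## Optimal tours of one agent -/

/-- Result of the search for the first minimum of `g` among the packages of `M` less than `e`:
index and value of the minimum, or `m` and a default value. -/
def IsScan (M : Finset (Fin m)) (g : Fin m → ℝ) (d : ℝ) (e ch : ℕ) (x : ℝ) : Prop :=
  (M.filter fun j : Fin m => (j : ℕ) < e) = ∅ ∧ ch = m ∧ x = d ∨
    ∃ b : Fin m, Instance.IsFirstArgmin (M.filter fun j : Fin m => (j : ℕ) < e) g b ∧ ch = b ∧ x = g b

theorem filter_lt_succ_of_mem {M : Finset (Fin m)} {j : Fin m} (hj : j ∈ M) :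
    (M.filter fun x : Fin m => (x : ℕ) < j + 1) = insert j (M.filter fun x : Fin m => (x : ℕ) < j) := by
  ext x
  simp only [Finset.mem_filter, Finset.mem_insert, Nat.lt_succ_iff_lt_or_eq, ← Fin.ext_iff]
  constructor
  · rintro ⟨h, h' | h'⟩
    exacts [.inr ⟨h, h'⟩, .inl h']
  · rintro (rfl | h)
    exacts [⟨hj, .inr rfl⟩, ⟨h.1, .inl h.2⟩]

theorem filter_lt_succ_of_notMem {M : Finset (Fin m)} {j : Fin m} (hj : j ∉ M) :
    (M.filter fun x : Fin m => (x : ℕ) < j + 1) = M.filter fun x : Fin m => (x : ℕ) < j := by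
  refine Finset.filter_congr fun x hx => ?_
  have : (x : ℕ) ≠ j := fun h => hj (Fin.ext h ▸ hx)
  omega

theorem IsScan.succ_of_notMem {M : Finset (Fin m)} {g : Fin m → ℝ} {d x : ℝ} {ch : ℕ} {j : Fin m}
    (h : IsScan M g d j ch x) (hj : j ∉ M) : IsScan M g d (j + 1) ch x := by
  rwa [IsScan, filter_lt_succ_of_notMem hj]

/-- While the index is the sentinel `m`, nothing has been found and the first candidate is taken
without comparison; hence the condition on `ch`. -/
theorem IsScan.succ_of_lt {M : Finset (Fin m)} {g : Fin m → ℝ} {d x : ℝ} {ch : ℕ} {j : Fin m}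
    (h : IsScan M g d j ch x) (hj : j ∈ M) (hlt : ch < m → g j < x) :
    IsScan M g d (j + 1) j (g j) := by
  refine .inr ⟨j, ⟨by simp [hj], ?_⟩, rfl, rfl⟩
  rw [filter_lt_succ_of_mem hj]
  intro i hi
  rcases Finset.mem_insert.1 hi with rfl | hi
  · exact ⟨le_rfl, fun h => absurd h (lt_irrefl _)⟩
  · rcases h with ⟨he, -, -⟩ | ⟨b, hb, rfl, rfl⟩
    · rw [he] at hi
      exact absurd hi (Finset.notMem_empty i)
    · have := (hlt b.2).trans_le (hb.2 i hi).1
      exact ⟨this.le, fun _ => this⟩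

/-- On ties the earlier package is kept, which makes the result the first minimizer. -/
theorem IsScan.succ_of_le {M : Finset (Fin m)} {g : Fin m → ℝ} {d x : ℝ} {ch : ℕ} {j : Fin m}
    (h : IsScan M g d j ch x) (hj : j ∈ M) (hch : ch < m) (hle : x ≤ g j) :
    IsScan M g d (j + 1) ch x := by
  rcases h with ⟨-, rfl, -⟩ | ⟨b, hb, rfl, rfl⟩
  · exact absurd hch (lt_irrefl _)
  · refine .inr ⟨b, ?_, rfl, rfl⟩
    have hbj : (b : ℕ) < j := (Finset.mem_filter.1 hb.1).2
    rw [filter_lt_succ_of_mem hj]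
    refine ⟨Finset.mem_insert_of_mem hb.1, fun i hi => ?_⟩
    rcases Finset.mem_insert.1 hi with rfl | hi
    · exact ⟨hle, fun h => absurd h (not_lt.2 (Fin.le_def.2 hbj.le))⟩
    · exact hb.2 i hi

/-- The table entries for the optimal route from `u` to `p` that delivers the packages of `M`. -/
def Store.HasRoute (s : Store) (I : Instance n m k) (p : Fin n) (M : Finset (Fin m)) (u : Fin n) :
    Prop :=
  s.real 3 (setCode M) u = I.optLen p M u ∧
    ∀ b, Instance.IsFirstArgmin M (I.optVia p M u) b → s.nat 9 (setCode M) u = b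

/-- After a full scan the sentinel survives only for the empty set, where the default value is the
way straight back. -/
theorem IsScan.optLen_eq {M : Finset (Fin m)} {p u : Fin n} {x : ℝ} {ch : ℕ}
    (h : IsScan M (I.optVia p M u) (I.dist u p) m ch x) :
    x = I.optLen p M u ∧ ∀ b, Instance.IsFirstArgmin M (I.optVia p M u) b → ch = b := by
  have hM : (M.filter fun j : Fin m => (j : ℕ) < m) = M := Finset.filter_true_of_mem fun j _ => j.2
  rw [IsScan, hM] at h
  rcases h with ⟨rfl, rfl, rfl⟩ | ⟨b, hb, rfl, rfl⟩
  · exact ⟨(I.optLen_empty p u).symm, fun b hb => absurd hb.1 (Finset.notMem_empty b)⟩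
  · exact ⟨hb.optLen_eq.symm, fun a ha => by rw [ha.unique hb]⟩

namespace Program

/-- Search for the first package in an optimal route. -/
def scanPackages : Program :=
  forLoop 12 .packages
    (ite (.natLe (.const 1) (.get 8 (.var 18) (.var 12)))
      (.seq
        (setRealVar 7 (.add (.add (.get 2 (.var 11) (.arr 3 (.var 12)))
            (.get 2 (.arr 3 (.var 12)) (.arr 4 (.var 12))))
          (.get 3 (.sub (.var 18) (.arr 7 (.var 12))) (.arr 4 (.var 12)))))
        (ite (.not (.and (.not (.natLe .packages (.var 19))) (.realLe (.var 6) (.var 7))))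
          (.seq (setRealVar 6 (.var 7)) (setVar 19 (.var 12)))
          skip))
      skip)

/-- One evaluation of the Bellman minimum, assuming that the table is correct for all smaller codes.
-/
theorem scanPackages_ends {q R : ℕ} {s : Store} (hs : s.HasInput I w) (hm : m ≤ q)
    (hd : ∀ u v : Fin n, s.real 2 u v = I.dist u v) (hsets : s.HasSets m) {p u : Fin n}
    {M : Finset (Fin m)} (hM : s.nat 18 0 0 = setCode M) (hu : s.nat 11 0 0 = u)
    (hlt : ∀ M', setCode M' < setCode M → ∀ u, s.HasRoute I p M' u)
    (hch : s.nat 19 0 0 = m) (hcur : s.real 6 0 0 = I.dist u p) :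
    scanPackages.Ends q R s fun s' =>
      IsScan M (I.optVia p M u) (I.dist u p) m (s'.nat 19 0 0) (s'.real 6 0 0) := by
  refine .forFin (fun e s => IsScan M (I.optVia p M u) (I.dist u p) e (s.nat 19 0 0)
    (s.real 6 0 0)) rfl hm (fun s' hf => (hs.frame hf rfl).packages) ?_ (fun j s₁ hf hj hI => ?_)
    (fun s' _ hI => hI)
  · exact .inl ⟨by simp, by simpa using hch, by simpa using hcur⟩
  · have hs₁ := hs.frame hf rfl
    have hsets₁ := hsets.frame hf rfl rfl
    have hM₁ : s₁.nat 18 0 0 = setCode M := by rw [hf.nat 18 rfl, hM]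
    refine .ite (fun hb => ?_) (fun hb => .skip ?_)
    · have hjM : j ∈ M := by
        by_contra hjM
        simp [hM₁, hj, hsets₁.mem, hjM] at hb
      have hcode := setCode_erase_add hjM
      have herase : setCode M - 2 ^ (j : ℕ) = setCode (M.erase j) := by omega
      have hroute := hlt (M.erase j) (by have := Nat.two_pow_pos (j : ℕ); omega) (I.tgt j)
      refine Ends.andThen (Q := fun s => s.real 7 0 0 = I.optVia p M u j ∧
        s.real 6 0 0 = s₁.real 6 0 0) (.setReal ?_) fun s₂ hf₂ h₂ => ?_
      · have e1 : s₁.real 3 (setCode (M.erase j)) (I.tgt j) = I.optLen p (M.erase j) (I.tgt j) := by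
          rw [hf.real 3 rfl]; exact hroute.1
        have e2 : s₁.nat 7 j 0 = 2 ^ (j : ℕ) := hsets₁.pow j j.2.le
        have e3 : s₁.nat 11 0 0 = u := by rw [hf.nat 11 rfl, hu]
        have e4 : ∀ u v : Fin n, s₁.real 2 u v = I.dist u v := by rw [hf.real 2 rfl]; exact hd
        simp [hj, hM₁, hs₁.src, hs₁.tgt, e1, e2, e3, e4, herase, Instance.optVia, Instance.legLen]
      · rw [← h₂.2, ← hf₂.nat 19 rfl] at hI
        have hj₂ : s₂.nat 12 0 0 = j := by rw [hf₂.nat 12 rfl, hj]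
        have hm₂ := (hs₁.frame hf₂ rfl).packages
        refine .ite (fun hb => .seq (.setReal (.setNat ?_))) (fun hb => .skip ?_)
        · simp only [BExp.holds, NExp.eval, RExp.eval, h₂.1, hm₂] at hb
          simpa [hj₂, h₂.1] using hI.succ_of_lt hjM fun h => by
            by_contra hle
            exact hb ⟨not_le.2 h, not_lt.1 hle⟩
        · simp only [BExp.holds, NExp.eval, RExp.eval, h₂.1, hm₂, not_not, not_le] at hb
          simpa using hI.succ_of_le hjM hb.1 hb.2
    · have hjM : j ∉ M := by
        intro hjM
        simp [hM₁, hj, hsets₁.mem, hjM] at hb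
      simpa using hI.succ_of_notMem hjM

/-- The tables of optimal routes of the agent with index in the array `17`. -/
def routes : Program :=
  forLoop 18 (.arr 7 .packages)
    (forLoop 11 .nodes
      (.seq (setVar 19 .packages)
      (.seq (setRealVar 6 (.get 2 (.var 11) (.arr 2 (.var 17))))
      (.seq scanPackages
      (.seq (setReal 3 (.var 18) (.var 11) (.var 6))
        (setNat 9 (.var 18) (.var 11) (.var 19)))))))

theorem routes_ends {q R : ℕ} {s : Store} (hs : s.HasInput I w) (hm : m ≤ q) (hn : n ≤ q)
    (hR : 2 ^ m ≤ R) (hd : ∀ u v : Fin n, s.real 2 u v = I.dist u v) (hsets : s.HasSets m)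
    {i : Fin k} (hi : s.nat 17 0 0 = i) :
    routes.Ends q R s fun s' => ∀ M u, s'.HasRoute I (I.start i) M u := by
  refine .forFin (N := 2 ^ m) (fun c s => ∀ M, setCode M < c → ∀ u, s.HasRoute I (I.start i) M u)
    rfl hR (fun s' hf => ?_) (by simp) (fun c s₁ hf₁ hc hI₁ => ?_)
    (fun s' _ hI M u => hI M (setCode_lt M) u)
  · simp [(hs.frame hf rfl).packages, hf.nat 7 rfl, hsets.pow]
  -- The counter is the code of a set; processing in increasing order has already treated every set
  -- with one package less.
  obtain ⟨M, hM⟩ := exists_setCode_eq c.2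
  rw [← hM] at hc hI₁ ⊢
  have hs₁ := hs.frame hf₁ rfl
  refine .forFin (fun d s => (∀ M', setCode M' < setCode M → ∀ u, s.HasRoute I (I.start i) M' u) ∧
    ∀ u : Fin n, (u : ℕ) < d → s.HasRoute I (I.start i) M u) rfl hn
    (fun s' hf => (hs₁.frame hf rfl).nodes) ⟨?_, by simp⟩ (fun u s₂ hf₂ hu hI₂ => ?_)
    (fun s' _ hI M' hM' u => ?_)
  · simpa [Store.HasRoute] using hI₁
  · have hs₂ := hs₁.frame hf₂ rfl
    have hi₂ : s₂.nat 17 0 0 = i := by rw [hf₂.nat 17 rfl, hf₁.nat 17 rfl, hi]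
    have hc₂ : s₂.nat 18 0 0 = setCode M := by rw [hf₂.nat 18 rfl, hc]
    have hd₂ : ∀ u v : Fin n, s₂.real 2 u v = I.dist u v := by
      rw [hf₂.real 2 rfl, hf₁.real 2 rfl]; exact hd
    have hsets₂ := (hsets.frame hf₁ rfl rfl).frame hf₂ rfl rfl
    refine Ends.andThen (Q := fun s => s.nat 19 0 0 = m) (.setNat (by simp [hs₂.packages]))
      fun s₃ hf₃ h₃ => ?_
    have hs₃ := hs₂.frame hf₃ rfl
    refine Ends.andThen (Q := fun s => s.real 6 0 0 = I.dist u (I.start i)) (.setReal ?_)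
      fun s₄ hf₄ h₄ => ?_
    · simp [hf₃.nat 11 rfl, hf₃.nat 17 rfl, hf₃.real 2 rfl, hu, hi₂, hs₃.start, hd₂]
    have hr₄ : ∀ M u, s₂.HasRoute I (I.start i) M u → s₄.HasRoute I (I.start i) M u := by
      intro M u h
      rwa [Store.HasRoute, hf₄.nat 9 rfl, hf₄.real 3 rfl, hf₃.nat 9 rfl, hf₃.real 3 rfl]
    have hc₄ : s₄.nat 18 0 0 = setCode M := by rw [hf₄.nat 18 rfl, hf₃.nat 18 rfl, hc₂]
    have hu₄ : s₄.nat 11 0 0 = u := by rw [hf₄.nat 11 rfl, hf₃.nat 11 rfl, hu]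
    refine Ends.andThen (scanPackages_ends (hs₃.frame hf₄ rfl) hm
      (by rw [hf₄.real 2 rfl, hf₃.real 2 rfl]; exact hd₂)
      ((hsets₂.frame hf₃ rfl rfl).frame hf₄ rfl rfl) hc₄ hu₄
      (fun M' hM' u => hr₄ _ _ (hI₂.1 M' hM' u)) (by rw [hf₄.nat 19 rfl, h₃]) h₄)
      fun s₅ hf₅ h₅ => .seq (.setReal (.setNat ?_))
    have hc₅ : s₅.nat 18 0 0 = setCode M := by rw [hf₅.nat 18 rfl, hc₄]
    have hu₅ : s₅.nat 11 0 0 = u := by rw [hf₅.nat 11 rfl, hu₄]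
    have hscan := h₅.optLen_eq
    refine ⟨fun M' hM' v => ?_, (forall_lt_succ_iff u).2 ⟨fun v hv => ?_, ?_⟩⟩
    · have := hr₄ _ _ (hI₂.1 M' hM' v)
      simpa [Store.HasRoute, hc₅, hM'.ne, hf₅.real 3 rfl, hf₅.nat 9 rfl] using this
    · have := hr₄ _ _ (hI₂.2 v hv)
      simpa [Store.HasRoute, hu₅, hv.ne, hf₅.real 3 rfl, hf₅.nat 9 rfl] using this
    · simpa [Store.HasRoute, hc₅, hu₅] using hscan
  · rcases Nat.lt_succ_iff_lt_or_eq.1 hM' with h | h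
    · simpa [Store.HasRoute] using hI.1 M' h u
    · obtain rfl := setCode_injective h
      simpa [Store.HasRoute] using hI.2 u u.2

/-- The lengths of the optimal tours of all agents. -/
def tourLengths : Program :=
  forLoop 17 .agents (.seq routes
    (forLoop 18 (.arr 7 .packages)
      (setReal 4 (.var 17) (.var 18) (.get 3 (.var 18) (.arr 2 (.var 17))))))

/-- Every agent reuses the same tables, so only the lengths from its starting node are kept, one row
per agent. -/
theorem tourLengths_ends {q R : ℕ} {s : Store} (hs : s.HasInput I w) (hm : m ≤ q) (hn : n ≤ q)
    (hk : k ≤ q) (hR : 2 ^ m ≤ R) (hd : ∀ u v : Fin n, s.real 2 u v = I.dist u v)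
    (hsets : s.HasSets m) :
    tourLengths.Ends q R s fun s' =>
      ∀ (i : Fin k) M, s'.real 4 i (setCode M) = I.optLen (I.start i) M (I.start i) := by
  refine .forFin (fun c s => ∀ i : Fin k, (i : ℕ) < c → ∀ M,
      s.real 4 i (setCode M) = I.optLen (I.start i) M (I.start i)) rfl hk
    (fun s' hf => (hs.frame hf rfl).agents) (by simp) (fun i s₁ hf₁ hi hI₁ => ?_)
    (fun s' _ hI i => hI i i.2)
  have hs₁ := hs.frame hf₁ rfl
  have hsets₁ := hsets.frame hf₁ rfl rfl
  refine Ends.andThen (routes_ends hs₁ hm hn hR (by rw [hf₁.real 2 rfl]; exact hd) hsets₁ hi)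
    fun s₂ hf₂ h₂ => ?_
  have hs₂ := hs₁.frame hf₂ rfl
  have hsets₂ := hsets₁.frame hf₂ rfl rfl
  rw [← hf₂.real 4 rfl] at hI₁
  refine .forFin (N := 2 ^ m) (fun c s => (∀ j : Fin k, (j : ℕ) < i → s.real 4 j = s₂.real 4 j) ∧
      ∀ M, setCode M < c → s.real 4 i (setCode M) = I.optLen (I.start i) M (I.start i))
    rfl hR (fun s' hf => ?_) (by simp) (fun c s₃ hf₃ hc hI₃ => .setReal ?_) (fun s' _ hI => ?_)
  · simp [(hs₂.frame hf rfl).packages, hf.nat 7 rfl, hsets₂.pow]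
  · have hi₃ : s₃.nat 17 0 0 = i := by rw [hf₃.nat 17 rfl, hf₂.nat 17 rfl, hi]
    have hs₃ := hs₂.frame hf₃ rfl
    refine ⟨fun j hj => ?_, fun M hM => ?_⟩
    · funext x
      simpa [hi₃, hj.ne] using congrFun (hI₃.1 j hj) x
    · rcases Nat.lt_succ_iff_lt_or_eq.1 hM with h | h
      · simpa [hi₃, hc, h.ne] using hI₃.2 M h
      · simp [hi₃, hc, ← h, hs₃.start, hf₃.real 3 rfl, (h₂ M (I.start i)).1]
  · refine (forall_lt_succ_iff i).2 ⟨fun j hj M => ?_, fun M => ?_⟩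
    · simpa [hI.1 j hj] using hI₁ j hj M
    · simpa using hI.2 M (setCode_lt M)

end Program

end

section

variable {n m k : ℕ} {I : Instance n m k} {w : Fin k → ℝ}

/-! ## Enumeration of the assignments -/

/-- The code of the packages less than `t` that are assigned to agent `i`. -/
def partCode (f : Fin m → Fin k) (t : ℕ) (i : Fin k) : ℕ :=
  setCode (Finset.univ.filter fun j : Fin m => (j : ℕ) < t ∧ f j = i)

theorem partCode_eq_sum (f : Fin m → Fin k) (t : ℕ) (i : Fin k) :
    partCode f t i = ∑ j : Fin m, if (j : ℕ) < t ∧ f j = i then 2 ^ (j : ℕ) else 0 := by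
  rw [partCode, setCode, Finset.sum_filter]

@[simp] theorem partCode_zero (f : Fin m → Fin k) (i : Fin k) : partCode f 0 i = 0 := by
  simp [partCode_eq_sum]

theorem partCode_all (f : Fin m → Fin k) (i : Fin k) :
    partCode f m i = setCode (Finset.univ.filter fun j => f j = i) := by
  simp [partCode]

theorem partCode_succ (f : Fin m → Fin k) (t : Fin m) (i : Fin k) :
    partCode f (t + 1) i = partCode f t i + if i = f t then 2 ^ (t : ℕ) else 0 := by
  have h : (if i = f t then 2 ^ (t : ℕ) else 0) =
      ∑ j : Fin m, if j = t then (if i = f t then 2 ^ (t : ℕ) else 0) else 0 := by simp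
  rw [partCode_eq_sum, partCode_eq_sum, h, ← Finset.sum_add_distrib]
  refine Finset.sum_congr rfl fun j _ => ?_
  by_cases hj : j = t
  · subst hj
    simp [eq_comm]
  · have hne : (j : ℕ) ≠ t := fun h => hj (Fin.ext h)
    simp only [hj, if_false, add_zero]
    exact if_congr (and_congr_left' (by omega)) rfl rfl

theorem partCode_update (f : Fin m → Fin k) (t : Fin m) (a i : Fin k) :
    partCode (Function.update f t a) t i = partCode f t i := by
  rw [partCode_eq_sum, partCode_eq_sum]
  refine Finset.sum_congr rfl fun j _ => ?_
  by_cases hj : j = t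
  · simp [hj]
  · rw [Function.update_of_ne hj]

/-- The row describes the assignment `f` of the packages less than `t`. -/
def IsRow (t : ℕ) (f : Fin m → Fin k) (row : ℕ → ℕ) : Prop := ∀ i : Fin k, row i = partCode f t i

theorem IsRow.succ {t : Fin m} {f : Fin m → Fin k} {row row' : ℕ → ℕ} (h : IsRow t f row)
    (h' : ∀ i : Fin k, row' i = row i + if i = f t then 2 ^ (t : ℕ) else 0) :
    IsRow (t + 1) f row' := fun i => by rw [h', h i, partCode_succ]

theorem IsRow.update {t : Fin m} {f : Fin m → Fin k} {row : ℕ → ℕ} (h : IsRow t f row)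
    (a : Fin k) : IsRow t (Function.update f t a) row := fun i => by rw [h i, partCode_update]

/-- The rows of the array `10` between the indices in the arrays `20` and `21` describe all
assignments of the packages less than `t`. -/
structure Store.HasRows (s : Store) (m k t : ℕ) : Prop where
  size : s.nat 21 0 0 = s.nat 20 0 0 + k ^ t
  sound : ∀ r < k ^ t, ∃ f : Fin m → Fin k, IsRow t f (s.nat 10 (s.nat 20 0 0 + r))
  complete : ∀ f : Fin m → Fin k, ∃ r < k ^ t, IsRow t f (s.nat 10 (s.nat 20 0 0 + r))

namespace Program

/-- The assignments that extend the one in a row by one package. -/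
def extendRow : Program :=
  forLoop 11 .agents
    (.seq (forLoop 12 .agents
      (setNat 10 (.var 22) (.var 12) (.get 10 (.add (.var 20) (.var 15)) (.var 12))))
    (.seq (setNat 10 (.var 22) (.var 11) (.add (.get 10 (.var 22) (.var 11)) (.arr 7 (.var 14))))
      (setVar 22 (.add (.var 22) (.const 1)))))

/-- Progress of the extension of the rows from `lo` on: the next free row is `hi + c * k + a`, and
the first `c` rows have been extended, as well as the next one for the agents less than `a`. -/
structure Extended (old s : Store) (t : Fin m) (k lo hi c a : ℕ) : Prop where
  next : s.nat 22 0 0 = hi + c * k + a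
  old_eq : ∀ r < hi, s.nat 10 r = old.nat 10 r
  sound : ∀ r, hi ≤ r → r < hi + c * k + a → ∃ f : Fin m → Fin k, IsRow (t + 1) f (s.nat 10 r)
  complete : ∀ f : Fin m → Fin k, ∀ r, (r < c ∨ r = c ∧ (f t : ℕ) < a) →
    IsRow t f (old.nat 10 (lo + r)) →
    ∃ r', hi ≤ r' ∧ r' < hi + c * k + a ∧ IsRow (t + 1) f (s.nat 10 r')

theorem Extended.congr {old s s' : Store} {t : Fin m} {lo hi c a : ℕ}
    (h : Extended old s t k lo hi c a) (h22 : s'.nat 22 = s.nat 22) (h10 : s'.nat 10 = s.nat 10) :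
    Extended old s' t k lo hi c a := by
  obtain ⟨h1, h2, h3, h4⟩ := h
  constructor <;> simpa only [h22, h10]

theorem Extended.next_row {old s : Store} {t : Fin m} {lo hi c : ℕ}
    (h : Extended old s t k lo hi c k) : Extended old s t k lo hi (c + 1) 0 := by
  have e : hi + (c + 1) * k + 0 = hi + c * k + k := by ring
  refine ⟨by rw [e]; exact h.next, h.old_eq, by rw [e]; exact h.sound, fun f r hr => ?_⟩
  rw [e]
  exact h.complete f r (by have := (f t).2; omega)

theorem Extended.next_agent {old s s' : Store} {t : Fin m} {lo hi c : ℕ} {a : Fin k}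
    (h : Extended old s t k lo hi c a) (hsound : ∃ f : Fin m → Fin k, IsRow t f (old.nat 10 (lo + c)))
    (hnext : s'.nat 22 0 0 = hi + c * k + a + 1)
    (hne : ∀ r, r ≠ hi + c * k + a → s'.nat 10 r = s.nat 10 r)
    (hrow : ∀ i : Fin k, s'.nat 10 (hi + c * k + a) i =
      old.nat 10 (lo + c) i + if i = a then 2 ^ (t : ℕ) else 0) :
    Extended old s' t k lo hi c (a + 1) := by
  have hlt : hi ≤ hi + c * k + a := by rw [add_assoc]; exact Nat.le_add_right _ _
  refine ⟨hnext, fun r hr => ?_, fun r h1 h2 => ?_, fun f r hr hf => ?_⟩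
  · rw [hne r (by omega), h.old_eq r hr]
  · by_cases hr : r = hi + c * k + a
    · obtain ⟨f, hf⟩ := hsound
      -- The source row does not depend on the agent of package `t`, so that package may be
      -- reassigned to `a` before the extension.
      exact ⟨_, (hf.update a).succ fun i => by rw [hr, hrow, Function.update_self]⟩
    · rw [hne r hr]
      exact h.sound r h1 (by omega)
  · by_cases hra : r = c ∧ f t = a
    · obtain ⟨rfl, rfl⟩ := hra
      exact ⟨_, hlt, by omega, hf.succ hrow⟩
    · have hra' : ¬ (r = c ∧ (f t : ℕ) = a) := fun h => hra ⟨h.1, Fin.ext h.2⟩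
      obtain ⟨r', h1, h2, h3⟩ := h.complete f r (by omega) hf
      exact ⟨r', h1, by omega, by rwa [hne r' (by omega)]⟩

/-- The source row lies below `hi`, where nothing is written; each of the `k` copies adds package
`t` to one agent. -/
theorem extendRow_ends {q R : ℕ} {s : Store} (hs : s.HasInput I w) (hk : k ≤ q) {old : Store}
    {t : Fin m} {lo hi c : ℕ} (h : Extended old s t k lo hi c 0) (ht : s.nat 14 0 0 = t)
    (hpow : s.nat 7 t 0 = 2 ^ (t : ℕ)) (hlo : s.nat 20 0 0 = lo) (hc : s.nat 15 0 0 = c)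
    (hhi : lo + c < hi) (hsound : ∃ f : Fin m → Fin k, IsRow t f (old.nat 10 (lo + c))) :
    extendRow.Ends q R s fun s' => Extended old s' t k lo hi (c + 1) 0 := by
  refine .forFin (fun a s => Extended old s t k lo hi c a) rfl hk
    (fun s' hf => (hs.frame hf rfl).agents) (h.congr (by simp) (by simp)) (fun a s₁ hf₁ ha hI₁ => ?_)
    (fun s' _ hI => hI.next_row)
  have hs₁ := hs.frame hf₁ rfl
  have hlo₁ : s₁.nat 20 0 0 = lo := by rw [hf₁.nat 20 rfl, hlo]
  have hc₁ : s₁.nat 15 0 0 = c := by rw [hf₁.nat 15 rfl, hc]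
  have ht₁ : s₁.nat 14 0 0 = t := by rw [hf₁.nat 14 rfl, ht]
  have hpow₁ : s₁.nat 7 t 0 = 2 ^ (t : ℕ) := by rw [hf₁.nat 7 rfl, hpow]
  have hlt : hi ≤ hi + c * k + a := by rw [add_assoc]; exact Nat.le_add_right _ _
  refine Ends.andThen (Q := fun s => (∀ r : ℕ, r ≠ hi + c * k + a → s.nat 10 r = s₁.nat 10 r) ∧
    ∀ i : Fin k, s.nat 10 (hi + c * k + a) i = old.nat 10 (lo + c) i) ?_ fun s₂ hf₂ h₂ => ?_
  · refine .forFin (fun b s => (∀ r : ℕ, r ≠ hi + c * k + a → s.nat 10 r = s₁.nat 10 r) ∧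
      ∀ i : Fin k, (i : ℕ) < b → s.nat 10 (hi + c * k + a) i = old.nat 10 (lo + c) i) rfl hk
      (fun s' hf => (hs₁.frame hf rfl).agents) (by simp) (fun b s₂ hf₂ hb hI₂ => .setNat ?_)
      (fun s' _ hI => ⟨hI.1, fun i => hI.2 i i.2⟩)
    have hlo₂ : s₂.nat 20 0 0 = lo := by rw [hf₂.nat 20 rfl, hlo₁]
    have hc₂ : s₂.nat 15 0 0 = c := by rw [hf₂.nat 15 rfl, hc₁]
    have hwp₂ : s₂.nat 22 0 0 = hi + c * k + a := by rw [hf₂.nat 22 rfl, hI₁.next]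
    have hold : s₂.nat 10 (lo + c) = old.nat 10 (lo + c) := by
      rw [hI₂.1 _ (by omega), hI₁.old_eq _ hhi]
    refine ⟨fun r hr => ?_, (forall_lt_succ_iff b).2 ⟨fun x hx => ?_, ?_⟩⟩
    · funext i
      simp [hwp₂, hr, hI₂.1 r hr]
    · simpa [hwp₂, hb, hx.ne] using hI₂.2 x hx
    · simp [hwp₂, hb, hlo₂, hc₂, hold]
  · have hwp₂ : s₂.nat 22 0 0 = hi + c * k + a := by rw [hf₂.nat 22 rfl, hI₁.next]
    have ha₂ : s₂.nat 11 0 0 = a := by rw [hf₂.nat 11 rfl, ha]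
    have ht₂ : s₂.nat 14 0 0 = t := by rw [hf₂.nat 14 rfl, ht₁]
    have hpow₂ : s₂.nat 7 t 0 = 2 ^ (t : ℕ) := by rw [hf₂.nat 7 rfl, hpow₁]
    refine .seq (.setNat (.setNat (hI₁.next_agent hsound ?_ (fun r hr => ?_) fun i => ?_)))
    · simp [hwp₂]
    · funext i
      simp [hwp₂, hr, h₂.1 r hr]
    · by_cases hia : i = a
      · simp [hwp₂, ha₂, hia, h₂.2, ht₂, hpow₂]
      · have : (i : ℕ) ≠ a := fun h => hia (Fin.ext h)
        simp [hwp₂, ha₂, hia, this, h₂.2]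

/-- A list of all assignments, as rows of the array `10`. -/
def assignments : Program :=
  .seq (setVar 20 (.const 0)) (.seq (setVar 21 (.const 1))
    (forLoop 14 .packages
      (.seq (setVar 22 (.var 21))
      (.seq (forLoop 15 (.sub (.var 21) (.var 20)) extendRow)
      (.seq (setVar 20 (.var 21)) (setVar 21 (.var 22)))))))

/-- A block of `k ^ t` rows is followed by its block of extensions, which becomes the next block.
Each stage is a single long loop of at most `k ^ m` rounds, so long loops are not nested. -/
theorem assignments_ends {q R : ℕ} {s : Store} (hs : s.HasInput I w) (hm : m ≤ q) (hk : k ≤ q)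
    (hR : k ^ m ≤ R) (hsets : s.HasSets m) (h0 : ∀ i, s.nat 10 0 i = 0) :
    assignments.Ends q R s fun s' => s'.HasRows m k m := by
  have hk0 : 0 < k := by have := I.one_lt_agents; omega
  refine Ends.andThen (Q := fun s => s.nat 20 0 0 = 0) (.setNat (by simp)) fun s₁ hf₁ h₁ => ?_
  refine Ends.andThen (Q := fun s => s.nat 21 0 0 = 1) (.setNat (by simp)) fun s₂ hf₂ h₂ => ?_
  have hs₂ := (hs.frame hf₁ rfl).frame hf₂ rfl
  have hsets₂ := (hsets.frame hf₁ rfl rfl).frame hf₂ rfl rfl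
  rw [← hf₂.nat 20 rfl] at h₁
  rw [← hf₁.nat 10 rfl, ← hf₂.nat 10 rfl] at h0
  refine .forFin (fun t s => s.HasRows m k t) rfl hm (fun s' hf => (hs₂.frame hf rfl).packages)
    ⟨?_, ?_, ?_⟩ (fun t s₃ hf₃ ht hI₃ => ?_) (fun s' _ hI => hI)
  · simp [h₁, h₂]
  · intro r hr
    obtain rfl : r = 0 := by simpa using hr
    -- Any assignment will do, since no package is less than zero; an agent exists because `k > 1`.
    exact ⟨fun _ => ⟨0, hk0⟩, by simp [h₁, IsRow, h0]⟩
  · simp [h₁, IsRow, h0]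
  have hs₃ := hs₂.frame hf₃ rfl
  have hsets₃ := hsets₂.frame hf₃ rfl rfl
  obtain ⟨hsize, hsound, hcomplete⟩ := hI₃
  generalize hlo : s₃.nat 20 0 0 = lo at hsize hsound hcomplete
  have hle : k ^ (t : ℕ) ≤ k ^ m := Nat.pow_le_pow_right hk0 t.2.le
  refine Ends.andThen (Q := fun s => s.nat 22 0 0 = lo + k ^ (t : ℕ)) (.setNat (by simp [hsize]))
    fun s₄ hf₄ h₄ => ?_
  have hs₄ := hs₃.frame hf₄ rfl
  have hsets₄ := hsets₃.frame hf₄ rfl rfl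
  have ht₄ : s₄.nat 14 0 0 = t := by rw [hf₄.nat 14 rfl, ht]
  have hlo₄ : s₄.nat 20 0 0 = lo := by rw [hf₄.nat 20 rfl, hlo]
  have hhi₄ : s₄.nat 21 0 0 = lo + k ^ (t : ℕ) := by rw [hf₄.nat 21 rfl, hsize]
  refine Ends.andThen (Q := fun s => Extended s₃ s t k lo (lo + k ^ (t : ℕ)) (k ^ (t : ℕ)) 0) ?_
    fun s₅ hf₅ h₅ => .seq (.setNat (.setNat ⟨?_, ?_, ?_⟩))
  · refine .forFin (N := k ^ (t : ℕ))
      (fun c s => Extended s₃ s t k lo (lo + k ^ (t : ℕ)) c 0) rfl (hle.trans hR)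
      (fun s' hf => by simp [hf.nat 20 rfl, hf.nat 21 rfl, hlo₄, hhi₄])
      ⟨by simp [h₄], by simp [hf₄.nat 10 rfl], by intros; omega, by intros; omega⟩
      (fun c s₅ hf₅ hc hI₅ => ?_) (fun s' _ hI => hI)
    refine (extendRow_ends (hs₄.frame hf₅ rfl) hk hI₅ (by rw [hf₅.nat 14 rfl, ht₄])
      ((hsets₄.frame hf₅ rfl rfl).pow t t.2.le) (by rw [hf₅.nat 20 rfl, hlo₄]) hc (by omega)
      (hsound c c.2)).imp fun s' _ h => h.congr (by simp) (by simp)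
  all_goals
    have hhi₅ : s₅.nat 21 0 0 = lo + k ^ (t : ℕ) := by rw [hf₅.nat 21 rfl, hhi₄]
    have hnext := h₅.next
    rw [add_zero, ← pow_succ] at hnext
  · simp [hhi₅, hnext]
  · intro r hr
    obtain ⟨f, hf⟩ := h₅.sound (lo + k ^ (t : ℕ) + r) (by omega) (by rw [← pow_succ]; omega)
    exact ⟨f, by simpa [hhi₅] using hf⟩
  · intro f
    obtain ⟨r, hr, hf⟩ := hcomplete f
    obtain ⟨r', h1, h2, h3⟩ := h₅.complete f r (.inl hr) hf
    rw [add_zero, ← pow_succ] at h2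
    obtain ⟨d, rfl⟩ := Nat.exists_eq_add_of_le h1
    exact ⟨d, by omega, by simpa [hhi₅] using h3⟩

/-! ### Selection of the cheapest assignment -/

/-- Search for the cheapest assignment. -/
def bestAssignment : Program :=
  forLoop 15 (.sub (.var 21) (.var 20))
    (.seq (setRealVar 7 .zero)
    (.seq (forLoop 11 .agents
      (setRealVar 7 (.add (.var 7) (.mul (.get 1 (.var 11) (.const 0))
        (.get 4 (.var 11) (.get 10 (.add (.var 20) (.var 15)) (.var 11)))))))
      (ite (.not (.and (.natLe (.const 1) (.var 15)) (.realLe (.var 8) (.var 7))))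
        (.seq (setRealVar 8 (.var 7)) (setVar 23 (.add (.var 20) (.var 15))))
        skip)))

theorem bestAssignment_ends {q R : ℕ} {s : Store} (hs : s.HasInput I w) (hk : k ≤ q)
    (hR : k ^ m ≤ R) (hrows : s.HasRows m k m)
    (hlen : ∀ (i : Fin k) M, s.real 4 i (setCode M) = I.optLen (I.start i) M (I.start i)) :
    bestAssignment.Ends q R s fun s' => ∃ f : Fin m → Fin k, IsRow m f (s'.nat 10 (s'.nat 23 0 0)) ∧
      ∀ f', I.planCost w (optTourRule.plan I f) ≤ I.planCost w (optTourRule.plan I f') := by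
  obtain ⟨hsize, hsound, hcomplete⟩ := hrows
  generalize hlo : s.nat 20 0 0 = lo at hsize hsound hcomplete
  let g : ℕ → ℝ := fun r => ∑ i : Fin k, w i * s.real 4 i (s.nat 10 (lo + r) i)
  have hg : ∀ r f, IsRow m f (s.nat 10 (lo + r)) → g r = I.planCost w (optTourRule.plan I f) := by
    intro r f hf
    rw [I.planCost_optTourRule]
    exact Finset.sum_congr rfl fun i _ => by rw [hf i, partCode_all, hlen]
  -- Before the first row there is no current minimum to compare with; the test `1 ≤ c` in the
  -- program forces the first row to be accepted.
  refine .forFin (N := k ^ m) (fun c s => c = 0 ∨ ∃ r < c, s.nat 23 0 0 = lo + r ∧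
    s.real 8 0 0 = g r ∧ ∀ r' < c, g r ≤ g r') rfl hR
    (fun s' hf => by simp [hf.nat 20 rfl, hf.nat 21 rfl, hlo, hsize]) (.inl rfl)
    (fun c s₁ hf₁ hc hI₁ => ?_) (fun s' hf hI => ?_)
  · have hs₁ := hs.frame hf₁ rfl
    refine Ends.andThen (Q := fun s => s.real 7 0 0 = 0) (.setReal (by simp)) fun s₂ hf₂ h₂ => ?_
    have hs₂ := hs₁.frame hf₂ rfl
    refine Ends.andThen (Q := fun s => s.real 7 0 0 = g c) ?_ fun s₃ hf₃ h₃ => ?_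
    · refine .forFin (fun d s' => s'.real 7 0 0 = ∑ i : Fin k, if (i : ℕ) < d then
        w i * s.real 4 i (s.nat 10 (lo + c) i) else 0) rfl hk
        (fun s' hf => (hs₂.frame hf rfl).agents) (by simp [h₂]) (fun i s₃ hf₃ hi hI₃ => .setReal ?_)
        (fun s' _ hI => by simpa using hI)
      have hs₃ := hs₂.frame hf₃ rfl
      rw [sum_ite_lt_succ]
      simp [hi, hI₃, hs₃.weight, hf₃.nat 20 rfl, hf₂.nat 20 rfl, hf₁.nat 20 rfl, hlo,
        hf₃.nat 15 rfl, hf₂.nat 15 rfl, hc, hf₃.nat 10 rfl, hf₂.nat 10 rfl, hf₁.nat 10 rfl,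
        hf₃.real 4 rfl, hf₂.real 4 rfl, hf₁.real 4 rfl]
    · rw [← hf₂.real 8 rfl, ← hf₃.real 8 rfl, ← hf₂.nat 23 rfl, ← hf₃.nat 23 rfl] at hI₁
      have hc₃ : s₃.nat 15 0 0 = c := by rw [hf₃.nat 15 rfl, hf₂.nat 15 rfl, hc]
      have hlo₃ : s₃.nat 20 0 0 = lo := by rw [hf₃.nat 20 rfl, hf₂.nat 20 rfl, hf₁.nat 20 rfl, hlo]
      refine .ite (fun hb => .seq (.setReal (.setNat (.inr ⟨c, by omega, ?_, ?_, ?_⟩))))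
        (fun hb => .skip (.inr ?_))
      · simp [hc₃, hlo₃]
      · simp [h₃]
      · intro r' hr'
        rcases Nat.lt_succ_iff_lt_or_eq.1 hr' with h | rfl
        · rcases hI₁ with h0 | ⟨r, hr, -, h8, hmin⟩
          · omega
          · simp only [BExp.holds, NExp.eval, RExp.eval, h₃, hc₃, h8] at hb
            have : ¬ g r ≤ g c := fun h' => hb ⟨by omega, h'⟩
            exact (not_le.1 this).le.trans (hmin r' h)
        · exact le_rfl
      · simp only [BExp.holds, NExp.eval, RExp.eval, h₃, hc₃, not_not] at hb
        rcases hI₁ with h0 | ⟨r, hr, h23, h8, hmin⟩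
        · omega
        · rw [h8] at hb
          refine ⟨r, by omega, by simpa using h23, by simpa using h8, fun r' hr' => ?_⟩
          rcases Nat.lt_succ_iff_lt_or_eq.1 hr' with h | rfl
          exacts [hmin r' h, hb.2]
  · have hpos : k ^ m ≠ 0 := pow_ne_zero m (by have := I.one_lt_agents; omega)
    obtain ⟨r, hr, h23, -, hmin⟩ := hI.resolve_left hpos
    obtain ⟨f, hf'⟩ := hsound r hr
    refine ⟨f, by rwa [h23, hf.nat 10 rfl], fun f' => ?_⟩
    obtain ⟨r', hr', hf''⟩ := hcomplete f'
    rw [← hg r f hf', ← hg r' f' hf'']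
    exact hmin r' hr'

/-! ## Output of the tours -/

/-- The order of the packages in the set with code in the array `24`. -/
def outputTour : Program :=
  forLoop 12 .packages
    (ite (.natLe (.const 1) (.var 24))
      (.seq (setVar 19 (.get 9 (.var 24) (.var 25)))
      (.seq (setNat 6 (.var 17) (.arr 5 (.var 17)) (.var 19))
      (.seq (setNat 5 (.var 17) (.const 0) (.add (.arr 5 (.var 17)) (.const 1)))
      (.seq (setVar 24 (.sub (.var 24) (.arr 7 (.var 19))))
        (setVar 25 (.arr 4 (.var 19)))))))
      skip)

/-- The rows of the output for agent `i` contain the list `l`. -/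
def OutputRow (s : Store) (i : ℕ) (l : List (Fin m)) : Prop :=
  s.nat 5 i 0 = l.length ∧ ∀ (r : ℕ) (hr : r < l.length), s.nat 6 i r = (l[r] : ℕ)

theorem outputTour_ends {q R : ℕ} {s : Store} (hs : s.HasInput I w) (hm : m ≤ q)
    (hsets : s.HasSets m) {i : Fin k} (hi : s.nat 17 0 0 = i)
    (hroute : ∀ M u, s.HasRoute I (I.start i) M u) {M : Finset (Fin m)} {u : Fin n}
    {l : List (Fin m)} (hl : I.IsGreedy (I.start i) u M l) (hM : s.nat 24 0 0 = setCode M)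
    (hu : s.nat 25 0 0 = u) (h0 : s.nat 5 i 0 = 0) :
    outputTour.Ends q R s fun s' => OutputRow s' i l ∧
      ∀ x, x ≠ (i : ℕ) → s'.nat 5 x = s.nat 5 x ∧ s'.nat 6 x = s.nat 6 x := by
  -- The list splits into the part already written and a greedy order of the remaining set. After
  -- `m` rounds the bound on its length leaves nothing; rounds with an empty set do nothing.
  refine .forFin (fun e s' => (∃ l₁ l₂ M u, l = l₁ ++ l₂ ∧ OutputRow s' i l₁ ∧
      s'.nat 24 0 0 = setCode M ∧ s'.nat 25 0 0 = (u : Fin n) ∧ I.IsGreedy (I.start i) u M l₂ ∧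
      l₂.length ≤ m - e) ∧ ∀ x, x ≠ (i : ℕ) → s'.nat 5 x = s.nat 5 x ∧ s'.nat 6 x = s.nat 6 x)
    rfl hm (fun s' hf => (hs.frame hf rfl).packages) ⟨⟨[], l, M, u, rfl, ?_, ?_, ?_, hl, ?_⟩, ?_⟩
    (fun e s₁ hf₁ he hI₁ => ?_) (fun s' _ hI => ?_)
  · simpa [OutputRow] using h0
  · simpa using hM
  · simpa using hu
  · rw [hl.length_eq]
    simpa using M.card_le_univ
  · simp
  · have hs₁ := hs.frame hf₁ rfl
    obtain ⟨⟨l₁, l₂, M', u', rfl, hout, hM', hu', hl₂, hlen⟩, hrest⟩ := hI₁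
    cases hl₂ with
    | nil =>
      refine .ite (fun hb => absurd hb (by simp [hM'])) fun hb => .skip
        ⟨⟨l₁, [], ∅, u', rfl, by simpa [OutputRow] using hout, by simpa using hM',
          by simpa using hu', .nil _, by simp⟩, by simpa using hrest⟩
    | @cons _ _ b l₂ hb hl₂ =>
      have hcode := setCode_erase_add hb.1
      have hpos := Nat.two_pow_pos (b : ℕ)
      have hi₁ : s₁.nat 17 0 0 = i := by rw [hf₁.nat 17 rfl, hi]
      refine .ite (fun _ => ?_) fun h => absurd (show 1 ≤ s₁.nat 24 0 0 by omega) h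
      refine Ends.andThen (Q := fun s => s.nat 19 0 0 = b) (.setNat ?_) fun s₂ hf₂ h₂ => ?_
      · simp [hM', hu', hf₁.nat 9 rfl, (hroute M' u').2 b hb]
      · have hs₂ := hs₁.frame hf₂ rfl
        have hi₂ : s₂.nat 17 0 0 = i := by rw [hf₂.nat 17 rfl, hi₁]
        have h24 : s₂.nat 24 0 0 = setCode M' := by rw [hf₂.nat 24 rfl, hM']
        have hpow : s₂.nat 7 b 0 = 2 ^ (b : ℕ) := by
          rw [hf₂.nat 7 rfl, hf₁.nat 7 rfl, hsets.pow b b.2.le]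
        have h5 : s₂.nat 5 = s₁.nat 5 := hf₂.nat 5 rfl
        have h6 : s₂.nat 6 = s₁.nat 6 := hf₂.nat 6 rfl
        refine .seq (.setNat (.seq (.setNat (.seq (.setNat (.setNat
          ⟨⟨l₁ ++ [b], l₂, M'.erase b, I.tgt b, by simp, ⟨?_, fun r hr => ?_⟩, ?_, ?_, hl₂, ?_⟩,
            fun x hx => ⟨?_, ?_⟩⟩))))))
        · simp [hi₂, h5, hout.1]
        · by_cases hrl : r < l₁.length
          · simp [hi₂, h5, h6, hout.1, hrl.ne, hout.2 r hrl, List.getElem_append_left hrl]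
          · have : r = l₁.length := by simp at hr; omega
            subst this
            simp [hi₂, h5, hout.1, h₂]
        · simp [h24, h₂, hpow]
          omega
        · simp [h₂, hs₂.tgt]
        · simp only [List.length_cons] at hlen
          omega
        · funext y
          simp [hi₂, hx, h5, (hrest x hx).1]
        · funext y
          simp [hi₂, hx, h6, (hrest x hx).2]
  · obtain ⟨⟨l₁, l₂, M', u', rfl, hout, -, -, -, hlen⟩, hrest⟩ := hI
    obtain rfl : l₂ = [] := List.eq_nil_of_length_eq_zero (by omega)
    rw [List.append_nil]
    exact ⟨hout, hrest⟩

/-- Output of the tours of all agents for the chosen assignment. -/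
def outputTours : Program :=
  forLoop 17 .agents
    (.seq routes
    (.seq (setVar 24 (.get 10 (.var 23) (.var 17)))
    (.seq (setVar 25 (.arr 2 (.var 17)))
    (.seq (setNat 5 (.var 17) (.const 0) (.const 0))
      outputTour))))

/-- The tables hold one agent at a time, so they are recomputed for each agent before its tour is
read off. -/
theorem outputTours_ends {q R : ℕ} {s : Store} (hs : s.HasInput I w) (hm : m ≤ q) (hn : n ≤ q)
    (hk : k ≤ q) (hR : 2 ^ m ≤ R) (hd : ∀ u v : Fin n, s.real 2 u v = I.dist u v)
    (hsets : s.HasSets m) {f : Fin m → Fin k} (hf : IsRow m f (s.nat 10 (s.nat 23 0 0))) :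
    outputTours.Ends q R s fun s' => s'.Outputs (optTourRule.plan I f) := by
  refine .forFin (fun c s => ∀ i : Fin k, (i : ℕ) < c → OutputRow s i (optTourRule.plan I f i))
    rfl hk (fun s' hf => (hs.frame hf rfl).agents) (by simp) (fun i s₁ hf₁ hi hI₁ => ?_)
    (fun s' _ hI i => hI i i.2)
  have hs₁ := hs.frame hf₁ rfl
  have hsets₁ := hsets.frame hf₁ rfl rfl
  refine Ends.andThen (routes_ends hs₁ hm hn hR (by rw [hf₁.real 2 rfl]; exact hd) hsets₁ hi)
    fun s₂ hf₂ h₂ => ?_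
  have hs₂ := hs₁.frame hf₂ rfl
  have hi₂ : s₂.nat 17 0 0 = i := by rw [hf₂.nat 17 rfl, hi]
  refine Ends.andThen (Q := fun s => s.nat 24 0 0 =
    setCode (Finset.univ.filter fun j => f j = i)) (.setNat ?_) fun s₃ hf₃ h₃ => ?_
  · have := hf i
    rw [partCode_all] at this
    simp [hi₂, hf₂.nat 10 rfl, hf₁.nat 10 rfl, hf₂.nat 23 rfl, hf₁.nat 23 rfl, this]
  have hs₃ := hs₂.frame hf₃ rfl
  have hi₃ : s₃.nat 17 0 0 = i := by rw [hf₃.nat 17 rfl, hi₂]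
  refine Ends.andThen (Q := fun s => s.nat 25 0 0 = I.start i) (.setNat ?_) fun s₄ hf₄ h₄ => ?_
  · simp [hi₃, hs₃.start]
  have hi₄ : s₄.nat 17 0 0 = i := by rw [hf₄.nat 17 rfl, hi₃]
  refine Ends.andThen (Q := fun s => s.nat 5 i 0 = 0 ∧ ∀ x, x ≠ (i : ℕ) → s.nat 5 x = s₄.nat 5 x)
    (.setNat ⟨by simp [hi₄], fun x hx => ?_⟩) fun s₅ hf₅ h₅ => ?_
  · funext y
    simp [hi₄, hx]
  refine (outputTour_ends ((hs₃.frame hf₄ rfl).frame hf₅ rfl) hm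
    ((((hsets₁.frame hf₂ rfl rfl).frame hf₃ rfl rfl).frame hf₄ rfl rfl).frame hf₅ rfl rfl)
    (by rw [hf₅.nat 17 rfl, hi₄])
    (fun M u => by
      rw [Store.HasRoute, hf₅.nat 9 rfl, hf₅.real 3 rfl, hf₄.nat 9 rfl, hf₄.real 3 rfl,
        hf₃.nat 9 rfl, hf₃.real 3 rfl]
      exact h₂ M u)
    (I.optTourRule_isGreedy i _) (by rw [hf₅.nat 24 rfl, hf₄.nat 24 rfl, h₃])
    (by rw [hf₅.nat 25 rfl, h₄]) h₅.1).imp fun s₆ hf₆ h₆ => ?_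
  refine (forall_lt_succ_iff i).2 ⟨fun x hx => ?_, by simpa [OutputRow, TourRule.plan] using h₆.1⟩
  have h6 := h₆.2 x hx.ne
  have := hI₁ x hx
  simp only [OutputRow] at this ⊢
  simpa [h6.1, h6.2, h₅.2 x hx.ne, hf₄.nat 5 rfl, hf₃.nat 5 rfl, hf₂.nat 5 rfl, hf₅.nat 6 rfl,
    hf₄.nat 6 rfl, hf₃.nat 6 rfl, hf₂.nat 6 rfl] using this

/-! ### The complete program and the main theorem -/

/-- The algorithm: the tours of each agent are found by dynamic programming over the sets of
packages, and the cheapest assignment by enumeration. -/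
def cheapestPlan : Program :=
  .seq distances (.seq sets (.seq tourLengths (.seq assignments (.seq bestAssignment outputTours))))

theorem cheapestPlan_ends (I : Instance n m k) (w : Fin k → ℝ) :
    cheapestPlan.Ends (n + m + k) (k ^ m) (I.input w) fun s => ∃ f : Fin m → Fin k,
      s.Outputs (optTourRule.plan I f) ∧
      ∀ f', I.planCost w (optTourRule.plan I f) ≤ I.planCost w (optTourRule.plan I f') := by
  have hn : n ≤ n + m + k := by omega
  have hm : m ≤ n + m + k := by omega
  have hk : k ≤ n + m + k := by omega
  -- Here `k > 1` brings the dynamic program over all sets within the time bound.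
  have hR : 2 ^ m ≤ k ^ m := Nat.pow_le_pow_left I.one_lt_agents m
  have hs := I.hasInput_input (w := w)
  refine Ends.andThen (distances_ends hs hn) fun s₁ hf₁ hd => ?_
  have hs₁ := hs.frame hf₁ rfl
  refine Ends.andThen (sets_ends hs₁ hm hR fun j => by rw [hf₁.nat 8 rfl]; rfl) fun s₂ hf₂ hsets => ?_
  have hs₂ := hs₁.frame hf₂ rfl
  rw [← hf₂.real 2 rfl] at hd
  refine Ends.andThen (tourLengths_ends hs₂ hm hn hk hR hd hsets) fun s₃ hf₃ hlen => ?_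
  have hs₃ := hs₂.frame hf₃ rfl
  have hsets₃ := hsets.frame hf₃ rfl rfl
  rw [← hf₃.real 2 rfl] at hd
  refine Ends.andThen (assignments_ends hs₃ hm hk le_rfl hsets₃ fun i => by
    rw [hf₃.nat 10 rfl, hf₂.nat 10 rfl, hf₁.nat 10 rfl]; rfl) fun s₄ hf₄ hrows => ?_
  have hs₄ := hs₃.frame hf₄ rfl
  have hsets₄ := hsets₃.frame hf₄ rfl rfl
  rw [← hf₄.real 2 rfl] at hd
  rw [← hf₄.real 4 rfl] at hlen
  refine Ends.andThen (bestAssignment_ends hs₄ hk le_rfl hrows hlen) fun s₅ hf₅ h₅ => ?_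
  obtain ⟨f, hrow, hmin⟩ := h₅
  rw [← hf₅.real 2 rfl] at hd
  exact (outputTours_ends (hs₄.frame hf₅ rfl) hm hn hk hR hd (hsets₄.frame hf₅ rfl rfl) hrow).imp
    fun s₆ _ h₆ => ⟨f, h₆, hmin⟩

end Program

end

end Delivery

theorem mainTheorem6 :
    ∃ (P : Delivery.Program) (T : Delivery.TourRule) (C D : ℕ),
      (∀ (n m k : ℕ) (I : Delivery.Instance n m k) (i : Fin k) (M : Finset (Fin m)),
        I.IsTourApprox (9 / 5) i M (T I i M)) ∧
      ∀ (n m k : ℕ) (I : Delivery.Instance n m k) (w : Fin k → ℝ), (∀ i, 0 ≤ w i) →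
        ∃ (s : Delivery.Store) (t : ℕ) (L : I.Plan),
          P.Exec (I.input w) s t ∧
          t ≤ C * (n + m + k) ^ D * k ^ m ∧
          s.Outputs L ∧
          L ∈ T.plans I ∧
          (∀ L' ∈ T.plans I, I.planCost w L ≤ I.planCost w L') ∧
          (∃ S, I.Executes S L) ∧
          (∃ opt, IsLeast (I.cost w '' I.directReturn) opt ∧
            ∀ S, I.Executes S L → I.cost w S ≤ 9 / 5 * opt) := by
  obtain ⟨C, D, htime⟩ := Delivery.Program.cheapestPlan.exists_time_le
  refine ⟨Delivery.Program.cheapestPlan, Delivery.optTourRule, C, D,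
    fun n m k I => I.optTourRule_isTourApprox, fun n m k I w hw => ?_⟩
  obtain ⟨s, t, hexec, ht, f, hout, hmin⟩ := Delivery.Program.cheapestPlan_ends I w
  have hk := I.one_lt_agents
  have hcost := htime (n + m + k) (k ^ m) (by omega) (Nat.pow_pos (by omega))
  -- Long loops are never nested, so `k ^ m` enters the bound to the first power.
  rw [show Delivery.Program.cheapestPlan.depth = 1 from rfl, pow_one] at hcost
  have hmin' : ∀ L' ∈ Delivery.optTourRule.plans I,
      I.planCost w (Delivery.optTourRule.plan I f) ≤ I.planCost w L' := by
    rintro _ ⟨f', rfl⟩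
    exact hmin f'
  refine ⟨s, t, _, hexec, ht.trans hcost, hout, ⟨f, rfl⟩, hmin',
    Delivery.Instance.exists_executes_optTourRule f, _,
    Delivery.Instance.isLeast_planCost hw ⟨f, rfl⟩ hmin', fun S hS => ?_⟩
  rw [hS.cost_eq]
  -- The plan is itself optimal; the factor 9/5 only needs a nonnegative cost.
  linarith [Delivery.Instance.planCost_nonneg hw (Delivery.optTourRule.plan I f)]
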